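/- Let $G'$ be a finite graph with vertex set $\{0,1,\dots,v'\}$, where $v'\ge 1$. Let $G(t)=G'$ for $t\le v'$, and for each $t\ge v'$ let $G(t+1)$ be obtained from $G(t)$ by adding a new vertex $t+1$ which, conditionally on the process up to stage $t$, is joined to each vertex $u\in\{0,\dots,t\}$ with probability $d_u(t)/t$, independently for different $u$, where $d_u(t)$ is the degree of $u$ in $G(t)$. Let $G(\infty)=\bigcup_t G(t)$ be the limit graph on $\{0,1,2,\dots\}$. The Rado graph is the graph (unique up to isomorphism) on a countably infinite vertex set such that for all disjoint finite sets $U,V$ of vertices there is a vertex outside $U\cup V$ adjacent to every vertex of $V$ and to no vertex of $U$. 1. If $G'$ is complete, then, with probability $1$, $G(\infty)$ is complete. 2. If $G'$ is edgeless, then, with probability $1$, $G(\infty)$ is edgeless. 3. If $G'$ is neither complete nor edgeless, then, with probability $1$, $G(\infty)$ is isomorphic to one of the following: the Rado graph together with a finite number (possibly $0$) of isolated vertices; or the Rado graph together with a finite number (possibly $0$) of universal vertices, that is, vertices adjacent to every other vertex. -/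

import Mathlib

open MeasureTheory

namespace PrefAttach

/-- `R` is (a copy of) the Rado graph: its vertex set is countably infinite and, for any disjoint
finite sets of vertices `U` and `V`, some vertex outside `U ∪ V` is adjacent to every vertex of `V`
and to no vertex of `U`. -/
structure IsRadoGraph {W : Type*} (R : SimpleGraph W) : Prop where
  countable : Countable W
  infinite : Infinite W
  extension : ∀ U V : Finset W, Disjoint U V →
    ∃ w, w ∉ U ∧ w ∉ V ∧ (∀ v ∈ V, R.Adj w v) ∧ ∀ u ∈ U, ¬ R.Adj w u

/-- A Rado graph exists: join `m < n` when the `m`-th binary digit of `n` is `1`. -/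
theorem exists_isRadoGraph : ∃ R : SimpleGraph ℕ, IsRadoGraph R := by
  refine ⟨SimpleGraph.fromRel fun m n => m < n ∧ n.testBit m = true, inferInstance, inferInstance,
    fun U V hUV => ?_⟩
  -- the witness has binary digits exactly at `V` and at one large position `N`
  obtain ⟨N, hN⟩ : ∃ N, ∀ x ∈ U ∪ V, x < N := ⟨(U ∪ V).sup id + 1, fun x hx =>
    Nat.lt_succ_of_le (Finset.le_sup (f := id) hx)⟩
  set S : Finset ℕ := insert N V
  set w : ℕ := Finset.equivBitIndices.symm S
  have hw : ∀ i, w.testBit i = true ↔ i ∈ S := by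
    intro i
    have h : Finset.equivBitIndices w = S := Finset.equivBitIndices.apply_symm_apply S
    rw [← h]
    simp [Finset.equivBitIndices]
  have hNw : N < w := lt_of_lt_of_le N.lt_two_pow_self
    (Nat.ge_two_pow_of_testBit ((hw N).2 (Finset.mem_insert_self N V)))
  have hlt : ∀ x ∈ U ∪ V, x < w := fun x hx => (hN x hx).trans hNw
  refine ⟨w, fun h => lt_irrefl _ (hlt w (Finset.mem_union_left _ h)),
    fun h => lt_irrefl _ (hlt w (Finset.mem_union_right _ h)), fun v hv => ?_, fun u hu => ?_⟩
  · have h := hlt v (Finset.mem_union_right _ hv)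
    exact (SimpleGraph.fromRel_adj _ _ _).2
      ⟨h.ne', Or.inr ⟨h, (hw v).2 (Finset.mem_insert_of_mem hv)⟩⟩
  · have h := hlt u (Finset.mem_union_left _ hu)
    rw [SimpleGraph.fromRel_adj]
    rintro ⟨-, ⟨h', -⟩ | ⟨-, h'⟩⟩
    · exact lt_asymm h h'
    · rcases Finset.mem_insert.1 ((hw u).1 h') with h1 | h1
      · exact (hN u (Finset.mem_union_left _ hu)).ne h1
      · exact Finset.disjoint_left.1 hUV hu h1

/-- The graph `R` together with `n` new isolated vertices. -/
def addIsolated {W : Type*} (R : SimpleGraph W) (n : ℕ) : SimpleGraph (W ⊕ Fin n) :=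
  R ⊕g (⊥ : SimpleGraph (Fin n))

/-- The graph `R` together with `n` new universal vertices: each of them is adjacent to every
other vertex, old or new. -/
def addUniversal {W : Type*} (R : SimpleGraph W) (n : ℕ) : SimpleGraph (W ⊕ Fin n) :=
  SimpleGraph.fromRel fun
    | Sum.inl a, Sum.inl b => R.Adj a b
    | _, _ => True

/-- The degree of the vertex `u` in the graph `H`. It is only used for graphs with finitely
many edges. -/
noncomputable def deg (H : SimpleGraph ℕ) (u : ℕ) : ℕ := (H.neighborSet u).ncard

/-- The probability that, when the graph on `{0, …, t}` is `H`, the neighbours of the new vertex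
`t + 1` are exactly the members of `S ⊆ {0, …, t}`: it is joined to each `u ≤ t` with
probability `deg H u / t`, independently for different `u`. -/
noncomputable def attachProb (H : SimpleGraph ℕ) (t : ℕ) (S : Finset ℕ) : ℝ :=
  ∏ u ∈ Finset.range (t + 1),
    if u ∈ S then (deg H u : ℝ) / t else 1 - (deg H u : ℝ) / t

/-- The graph obtained from `H`, a graph on `{0, …, t}`, by introducing the vertex `t + 1` and
joining it to the members of `S ⊆ {0, …, t}`. -/
def addVertex (H : SimpleGraph ℕ) (t : ℕ) (S : Finset ℕ) : SimpleGraph ℕ :=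
  H ⊔ SimpleGraph.fromRel fun a b => a = t + 1 ∧ b ∈ S

/-- `(G t)` is the linear preferential attachment process started from the graph `G'` on
`{0, …, v'}`. The graph `G t`, whose vertex set is `{0, …, t}` for `t ≥ v'`, is represented by its
edges, as a graph on `ℕ`. Since `G (t + 1)` extends `G t` by a single vertex, `G t` determines all
earlier stages, so that `transition` gives the conditional law of the next stage given the whole
history. -/
structure IsProcess {Ω : Type*} [MeasurableSpace Ω] (μ : Measure Ω) {v' : ℕ}
    (G' : SimpleGraph (Fin (v' + 1))) (G : ℕ → Ω → SimpleGraph ℕ) : Prop where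
  measurable : ∀ t a b, MeasurableSet {ω | (G t ω).Adj a b}
  init : ∀ t ≤ v', ∀ ω, G t ω = G'.map Fin.valEmbedding
  step : ∀ t ≥ v', ∀ ω, ∃ S ⊆ Finset.range (t + 1), G (t + 1) ω = addVertex (G t ω) t S
  transition : ∀ t ≥ v', ∀ H : SimpleGraph ℕ, ∀ S ⊆ Finset.range (t + 1),
    μ {ω | G t ω = H ∧ G (t + 1) ω = addVertex H t S} =
      μ {ω | G t ω = H} * ENNReal.ofReal (attachProb H t S)

/-- The infinite limit of a sequence of graphs: the graph on all of `ℕ` whose edges are those that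
appear at some stage. -/
def limitGraph {Ω : Type*} (G : ℕ → Ω → SimpleGraph ℕ) (ω : Ω) : SimpleGraph ℕ := ⨆ t, G t ω

end PrefAttach

/-!
Write `d` for the degree of a vertex at time `t`. It increases by one with probability `d / t`, so
the degrees of the vertices present at a given time evolve like independent Pólya urns, and so do
the codegrees `t - d`, with the roles of edges and non-edges exchanged: the complement of the
process is again a preferential attachment process (`IsProcess.compl`).

*Extension property.* The harmonic sum `∑_{d ≤ i < t} 1 / i`, which dominates `log (t / d)`, is a
nonnegative martingale along an urn. Let `L` be the sum of these potentials over the degrees of the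
vertices in `V` and the codegrees of those in `U`, where no member of `V` is isolated and no member
of `U` is universal. Then `L` is finite with constant expectation, and the next vertex is joined to
all of `V` and none of `U` with conditional probability at least `exp (-L)`. If with positive
probability no such vertex ever appeared, the probability that none has appeared by time `T` would
drop by a fixed amount at each step, which is absurd (`IsProcess.ae_exists_witness`).

*Few isolated vertices.* A vertex that has an edge gets infinitely many neighbours by the extension
property, so the sum `D` of the degrees becomes large. From then on the expectation of `t³ / D²`
is multiplied by at most `1 - 1 / (2 t)` in each step, while the next vertex is isolated
with probability at most `exp (-D / t) ≤ 2 t² / D²`. The expected number of further isolated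
vertices is therefore finite (`IsProcess.ae_finite_isolated`). Passing to the complement, there are
finitely many universal vertices.

*Conclusion.* A graph cannot have both isolated and universal vertices. If it has no universal
vertex, the extension property shows that its nonisolated vertices induce a Rado graph, which is
unique up to isomorphism by a back-and-forth argument (`HasExtensions.exists_iso_addIsolated`). The
other case follows by complementation. An edgeless graph never gains an edge, and complementation
also yields the case of the complete graph.
-/

namespace PrefAttach

/-! ### Graphs on an initial segment of `ℕ` -/

/-- All edges of `H` lie in `{0, …, t}`. -/
def SupportedTo (H : SimpleGraph ℕ) (t : ℕ) : Prop := ∀ a b, H.Adj a b → a ≤ t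

/-- The restriction of `H` to `{0, …, t}`, as a graph on `ℕ`. -/
def trunc (t : ℕ) (H : SimpleGraph ℕ) : SimpleGraph ℕ where
  Adj a b := H.Adj a b ∧ a ≤ t ∧ b ≤ t
  symm := ⟨fun _ _ h => ⟨h.1.symm, h.2.2, h.2.1⟩⟩
  loopless := ⟨fun _ h => h.1.ne rfl⟩

theorem trunc_adj {t : ℕ} {H : SimpleGraph ℕ} {a b : ℕ} :
    (trunc t H).Adj a b ↔ H.Adj a b ∧ a ≤ t ∧ b ≤ t := Iff.rfl

theorem SupportedTo.trunc_eq {H : SimpleGraph ℕ} {t : ℕ} (h : SupportedTo H t) :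
    trunc t H = H := by
  ext a b
  exact ⟨fun h' => h'.1, fun h' => ⟨h', h a b h', h b a h'.symm⟩⟩

theorem finite_supportedTo (t : ℕ) : {H : SimpleGraph ℕ | SupportedTo H t}.Finite := by
  let f : SimpleGraph ℕ → SimpleGraph (Fin (t + 1)) := fun H => H.comap Fin.val
  refine Set.Finite.of_injOn (f := f) (t := Set.univ) (fun _ _ => Set.mem_univ _) ?_
    Set.finite_univ
  intro H hH K hK hf
  ext a b
  have key : ∀ a b, a ≤ t → b ≤ t → (H.Adj a b ↔ K.Adj a b) := by
    intro a b ha hb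
    have : (f H).Adj ⟨a, by omega⟩ ⟨b, by omega⟩ ↔ (f K).Adj ⟨a, by omega⟩ ⟨b, by omega⟩ := by
      rw [hf]
    exact this
  constructor
  · intro h
    exact (key a b (hH a b h) (hH b a h.symm)).1 h
  · intro h
    exact (key a b (hK a b h) (hK b a h.symm)).2 h

theorem addVertex_adj {H : SimpleGraph ℕ} {t : ℕ} {S : Finset ℕ} {a b : ℕ} :
    (addVertex H t S).Adj a b ↔
      H.Adj a b ∨ (a ≠ b ∧ ((a = t + 1 ∧ b ∈ S) ∨ (b = t + 1 ∧ a ∈ S))) := by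
  simp [addVertex]

section

variable {H : SimpleGraph ℕ} {t : ℕ} {S : Finset ℕ}

theorem addVertex_adj_of_le {a b : ℕ} (ha : a ≤ t) (hb : b ≤ t) :
    (addVertex H t S).Adj a b ↔ H.Adj a b := by
  rw [addVertex_adj]
  refine or_iff_left ?_
  omega

theorem SupportedTo.addVertex_adj_new (hH : SupportedTo H t) (hS : S ⊆ Finset.range (t + 1))
    {b : ℕ} : (addVertex H t S).Adj (t + 1) b ↔ b ∈ S := by
  rw [addVertex_adj]
  constructor
  · rintro (h | ⟨hne, ⟨-, h⟩ | ⟨rfl, -⟩⟩)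
    · exact absurd (hH _ _ h) (by omega)
    · exact h
    · exact absurd rfl hne
  · intro h
    have := Finset.mem_range.1 (hS h)
    exact Or.inr ⟨by omega, Or.inl ⟨rfl, h⟩⟩

theorem supportedTo_addVertex (hH : SupportedTo H t) (hS : S ⊆ Finset.range (t + 1)) :
    SupportedTo (addVertex H t S) (t + 1) := by
  intro a b h
  rcases addVertex_adj.1 h with h | ⟨-, ⟨rfl, -⟩ | ⟨-, h⟩⟩
  · exact (hH _ _ h).trans (Nat.le_succ t)
  · exact le_rfl
  · exact (Finset.mem_range.1 (hS h)).le

theorem SupportedTo.neighborSet_subset (hH : SupportedTo H t) (u : ℕ) :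
    H.neighborSet u ⊆ ((Finset.range (t + 1)).erase u : Finset ℕ) := by
  intro b hb
  have hb' : H.Adj u b := hb
  have := hH _ _ hb'.symm
  simp only [Finset.coe_erase, Finset.coe_range, Set.mem_sdiff, Set.mem_Iio, Set.mem_singleton_iff]
  exact ⟨by omega, hb'.ne'⟩

theorem SupportedTo.finite_neighborSet (hH : SupportedTo H t) (u : ℕ) :
    (H.neighborSet u).Finite :=
  (Finset.finite_toSet _).subset (hH.neighborSet_subset u)

theorem SupportedTo.deg_le (hH : SupportedTo H t) {u : ℕ} (hu : u ≤ t) : deg H u ≤ t := by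
  have h := Set.ncard_le_ncard (hH.neighborSet_subset u) (Finset.finite_toSet _)
  rw [Set.ncard_coe_finset, Finset.card_erase_of_mem (Finset.mem_range.2 (by omega)),
    Finset.card_range] at h
  exact h

theorem SupportedTo.deg_addVertex (hH : SupportedTo H t) {u : ℕ} (hu : u ≤ t) :
    deg (addVertex H t S) u = deg H u + if u ∈ S then 1 else 0 := by
  unfold deg
  have hnot : t + 1 ∉ H.neighborSet u := fun h => by
    have := hH _ _ (SimpleGraph.Adj.symm h)
    omega
  split_ifs with h
  · rw [← Set.ncard_insert_of_notMem hnot (hH.finite_neighborSet u)]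
    congr 1
    ext b
    simp only [SimpleGraph.mem_neighborSet, Set.mem_insert_iff, addVertex_adj]
    constructor
    · rintro (h' | ⟨-, ⟨h1, -⟩ | ⟨h1, -⟩⟩)
      · exact Or.inr h'
      · omega
      · exact Or.inl h1
    · rintro (rfl | h')
      · exact Or.inr ⟨by omega, Or.inr ⟨rfl, h⟩⟩
      · exact Or.inl h'
  · rw [add_zero]
    congr 1
    ext b
    simp only [SimpleGraph.mem_neighborSet, addVertex_adj]
    constructor
    · rintro (h' | ⟨-, ⟨h1, -⟩ | ⟨-, h1⟩⟩)
      · exact h'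
      · omega
      · exact absurd h1 h
    · exact Or.inl

theorem SupportedTo.deg_addVertex_new (hH : SupportedTo H t) (hS : S ⊆ Finset.range (t + 1)) :
    deg (addVertex H t S) (t + 1) = S.card := by
  rw [deg, ← Set.ncard_coe_finset]
  congr 1
  ext b
  exact hH.addVertex_adj_new hS

/-- The sum of the degrees of the vertices `0, …, t`, that is, twice the number of edges of a graph
on `{0, …, t}`. -/
noncomputable def degSum (H : SimpleGraph ℕ) (t : ℕ) : ℕ := ∑ u ∈ Finset.range (t + 1), deg H u

theorem SupportedTo.degSum_addVertex (hH : SupportedTo H t) (hS : S ⊆ Finset.range (t + 1)) :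
    degSum (addVertex H t S) (t + 1) = degSum H t + 2 * S.card := by
  unfold degSum
  rw [Finset.sum_range_succ, hH.deg_addVertex_new hS,
    Finset.sum_congr rfl fun u hu =>
      hH.deg_addVertex (S := S) (Nat.lt_succ_iff.1 (Finset.mem_range.1 hu)),
    Finset.sum_add_distrib, Finset.sum_ite_mem, Finset.inter_eq_right.2 hS]
  simp
  ring

end

/-! ### Expectations over a random set with independent memberships -/

/-- The expectation of `φ S` when `S` is the random subset of `A` which contains each `u ∈ A`
with probability `p u`, independently for different `u`. -/
noncomputable def subsetMean (A : Finset ℕ) (p : ℕ → ℝ) (φ : Finset ℕ → ℝ) : ℝ :=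
  ∑ S ∈ A.powerset, (∏ u ∈ A, if u ∈ S then p u else 1 - p u) * φ S

section

variable {A : Finset ℕ} {p : ℕ → ℝ}

theorem subsetMean_add (φ ψ : Finset ℕ → ℝ) :
    subsetMean A p (fun S => φ S + ψ S) = subsetMean A p φ + subsetMean A p ψ := by
  simp [subsetMean, mul_add, Finset.sum_add_distrib]

theorem subsetMean_mul_left (c : ℝ) (φ : Finset ℕ → ℝ) :
    subsetMean A p (fun S => c * φ S) = c * subsetMean A p φ := by
  simp [subsetMean, Finset.mul_sum, mul_left_comm]

theorem subsetMean_sum {ι : Type*} (I : Finset ι) (φ : ι → Finset ℕ → ℝ) :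
    subsetMean A p (fun S => ∑ i ∈ I, φ i S) = ∑ i ∈ I, subsetMean A p (φ i) := by
  simp only [subsetMean, Finset.mul_sum]
  exact Finset.sum_comm

theorem subsetMean_congr {φ ψ : Finset ℕ → ℝ} (h : ∀ S ⊆ A, φ S = ψ S) :
    subsetMean A p φ = subsetMean A p ψ :=
  Finset.sum_congr rfl fun S hS => by rw [h S (Finset.mem_powerset.1 hS)]

theorem subsetMean_mono (hp : ∀ u ∈ A, 0 ≤ p u ∧ p u ≤ 1) {φ ψ : Finset ℕ → ℝ}
    (h : ∀ S ⊆ A, φ S ≤ ψ S) : subsetMean A p φ ≤ subsetMean A p ψ := by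
  refine Finset.sum_le_sum fun S hS => mul_le_mul_of_nonneg_left (h S (Finset.mem_powerset.1 hS)) ?_
  refine Finset.prod_nonneg fun u hu => ?_
  have := hp u hu
  split_ifs <;> linarith

open Classical in
/-- The random set contains `V` and avoids `U` with the probability that independence predicts. -/
theorem subsetMean_pattern {U V : Finset ℕ} (hU : U ⊆ A) (hV : V ⊆ A) (hUV : Disjoint U V) :
    subsetMean A p (fun S => if V ⊆ S ∧ Disjoint U S then 1 else 0) =
      (∏ v ∈ V, p v) * ∏ u ∈ U, (1 - p u) := by
  have hterm : ∀ S ∈ A.powerset, (∏ u ∈ A, if u ∈ S then p u else 1 - p u) *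
      (if V ⊆ S ∧ Disjoint U S then 1 else 0) =
      (∏ u ∈ S, if u ∈ U then 0 else p u) * ∏ u ∈ A \ S, if u ∈ V then 0 else 1 - p u := by
    intro S hS
    have hS := Finset.mem_powerset.1 hS
    rw [← Finset.prod_sdiff hS, mul_comm (∏ u ∈ A \ S, _)]
    split_ifs with h
    · rw [mul_one]
      congr 1
      · refine Finset.prod_congr rfl fun u hu => ?_
        have hu' : u ∉ U := fun h' => Finset.disjoint_left.1 h.2 h' hu
        simp [hu']
      · refine Finset.prod_congr rfl fun u hu => ?_
        have hu := (Finset.mem_sdiff.1 hu).2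
        have hu' : u ∉ V := fun h' => hu (h.1 h')
        simp [hu, hu']
    · rw [mul_zero, eq_comm]
      rw [not_and_or] at h
      rcases h with h | h
      · obtain ⟨v, hv, hvS⟩ := Finset.not_subset.1 h
        exact mul_eq_zero_of_right _
          (Finset.prod_eq_zero (Finset.mem_sdiff.2 ⟨hV hv, hvS⟩) (if_pos hv))
      · obtain ⟨u, hu, huS⟩ := Finset.not_disjoint_iff.1 h
        exact mul_eq_zero_of_left (Finset.prod_eq_zero huS (by simp [hu])) _
  rw [subsetMean, Finset.sum_congr rfl hterm, ← Finset.prod_add]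
  have h1 : ∀ u ∈ A, ((if u ∈ U then 0 else p u) + if u ∈ V then 0 else 1 - p u) =
      (if u ∈ V then p u else 1) * if u ∈ U then 1 - p u else 1 := by
    intro u _
    have : u ∈ U → u ∉ V := fun h => Finset.disjoint_left.1 hUV h
    split_ifs <;> first | (exfalso; tauto) | ring
  rw [Finset.prod_congr rfl h1, Finset.prod_mul_distrib, Finset.prod_ite_mem, Finset.prod_ite_mem,
    Finset.inter_eq_right.2 hU, Finset.inter_eq_right.2 hV]

theorem subsetMean_one : subsetMean A p (fun _ => 1) = 1 := by
  classical
  simpa using subsetMean_pattern (p := p) (Finset.empty_subset A) (Finset.empty_subset A)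
    (Finset.disjoint_empty_left _)

theorem subsetMean_const (c : ℝ) : subsetMean A p (fun _ => c) = c := by
  simpa [subsetMean_one] using subsetMean_mul_left (A := A) (p := p) c (fun _ => 1)

theorem subsetMean_mem {v : ℕ} (hv : v ∈ A) :
    subsetMean A p (fun S => if v ∈ S then 1 else 0) = p v := by
  classical
  simpa using subsetMean_pattern (p := p) (Finset.empty_subset A)
    (Finset.singleton_subset_iff.2 hv) (Finset.disjoint_empty_left _)

theorem subsetMean_mem_mul_mem {u v : ℕ} (hu : u ∈ A) (hv : v ∈ A) :
    subsetMean A p (fun S => (if u ∈ S then 1 else 0) * if v ∈ S then 1 else 0) =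
      if u = v then p u else p u * p v := by
  classical
  split_ifs with h
  · subst h
    rw [← subsetMean_mem (p := p) hu]
    exact subsetMean_congr fun S _ => by split_ifs <;> simp
  · have hV : ({u, v} : Finset ℕ) ⊆ A := by
      simp [Finset.insert_subset_iff, hu, hv]
    have := subsetMean_pattern (p := p) (Finset.empty_subset A) hV (Finset.disjoint_empty_left _)
    rw [Finset.prod_pair h, Finset.prod_empty, mul_one] at this
    rw [← this]
    refine subsetMean_congr fun S _ => ?_
    simp only [Finset.insert_subset_iff, Finset.singleton_subset_iff, Finset.disjoint_empty_left,
      and_true]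
    split_ifs <;> first | (exfalso; tauto) | simp

theorem card_eq_sum_mem {S : Finset ℕ} (hS : S ⊆ A) :
    (S.card : ℝ) = ∑ u ∈ A, if u ∈ S then 1 else 0 := by
  rw [Finset.sum_ite_mem, Finset.inter_eq_right.2 hS]
  simp

theorem subsetMean_card : subsetMean A p (fun S => (S.card : ℝ)) = ∑ u ∈ A, p u := by
  rw [subsetMean_congr fun S hS => card_eq_sum_mem hS, subsetMean_sum]
  exact Finset.sum_congr rfl fun u hu => subsetMean_mem hu

/-- The second moment of a sum of independent indicators. -/
theorem subsetMean_card_sq_le (hp : ∀ u ∈ A, 0 ≤ p u) :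
    subsetMean A p (fun S => (S.card : ℝ) ^ 2) ≤ (∑ u ∈ A, p u) ^ 2 + ∑ u ∈ A, p u := by
  have h1 : ∀ S ⊆ A, (S.card : ℝ) ^ 2 =
      ∑ u ∈ A, ∑ v ∈ A, (if u ∈ S then (1 : ℝ) else 0) * if v ∈ S then 1 else 0 := by
    intro S hS
    rw [sq, card_eq_sum_mem hS, Finset.sum_mul_sum]
  rw [subsetMean_congr h1, subsetMean_sum, sq, Finset.sum_mul_sum, ← Finset.sum_add_distrib]
  refine Finset.sum_le_sum fun u hu => ?_
  rw [subsetMean_sum, Finset.sum_congr rfl fun v hv => subsetMean_mem_mul_mem hu hv]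
  have h2 : ∀ v ∈ A, (if u = v then p u else p u * p v) ≤
      p u * p v + if u = v then p u else 0 := by
    intro v hv
    have := mul_nonneg (hp u hu) (hp v hv)
    split_ifs <;> linarith
  refine (Finset.sum_le_sum h2).trans ?_
  rw [Finset.sum_add_distrib, Finset.sum_ite_eq, if_pos hu]

theorem subsetMean_empty : subsetMean A p (fun S => if S = ∅ then 1 else 0) =
    ∏ u ∈ A, (1 - p u) := by
  classical
  have := subsetMean_pattern (p := p) subset_rfl (Finset.empty_subset A)
    (Finset.disjoint_empty_right A)
  rw [Finset.prod_empty, one_mul] at this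
  rw [← this]
  refine subsetMean_congr fun S hS => ?_
  congr 1
  simp only [Finset.empty_subset, true_and, eq_iff_iff]
  constructor
  · rintro rfl
    exact Finset.disjoint_empty_right A
  · intro h
    exact Finset.disjoint_self_iff_empty _ |>.1 (h.mono_left hS)

end

/-! ### The process and its one-step expectations -/

/-- An event that is determined by the graph at time `t`; since `G t` determines all the earlier
stages, these are the events of the past up to time `t`. -/
def PastEvent {Ω : Type*} (G : ℕ → Ω → SimpleGraph ℕ) (t : ℕ) (E : Set Ω) : Prop :=
  ∃ A : Set (SimpleGraph ℕ), G t ⁻¹' A = E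

theorem PastEvent.inter {Ω : Type*} {G : ℕ → Ω → SimpleGraph ℕ} {t : ℕ} {E F : Set Ω}
    (hE : PastEvent G t E) (hF : PastEvent G t F) : PastEvent G t (E ∩ F) := by
  obtain ⟨A, rfl⟩ := hE
  obtain ⟨B, rfl⟩ := hF
  exact ⟨A ∩ B, rfl⟩

namespace IsProcess

variable {Ω : Type*} [MeasurableSpace Ω] {μ : Measure Ω} {v' : ℕ} {G' : SimpleGraph (Fin (v' + 1))}
  {G : ℕ → Ω → SimpleGraph ℕ}

theorem supportedTo (hG : IsProcess μ G' G) {t : ℕ} (ht : v' ≤ t) (ω : Ω) :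
    SupportedTo (G t ω) t := by
  induction t, ht using Nat.le_induction with
  | base =>
    rw [hG.init v' le_rfl ω]
    rintro a b h
    obtain ⟨x, y, -, rfl, rfl⟩ := (SimpleGraph.map_adj _ _ _ _).1 h
    exact Nat.lt_succ_iff.1 x.2
  | succ t ht ih =>
    obtain ⟨S, hS, h⟩ := hG.step t ht ω
    rw [h]
    exact supportedTo_addVertex ih hS

theorem trunc_eq (hG : IsProcess μ G' G) {s t : ℕ} (hs : v' ≤ s) (hst : s ≤ t) (ω : Ω) :
    trunc s (G t ω) = G s ω := by
  induction t, hst using Nat.le_induction with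
  | base => exact (hG.supportedTo hs ω).trunc_eq
  | succ t hst ih =>
    have ht := hs.trans hst
    obtain ⟨S, hS, h⟩ := hG.step t ht ω
    rw [h, ← ih]
    ext a b
    simp only [trunc_adj]
    constructor
    · rintro ⟨h1, ha, hb⟩
      exact ⟨(addVertex_adj_of_le (ha.trans hst) (hb.trans hst)).1 h1, ha, hb⟩
    · rintro ⟨h1, ha, hb⟩
      exact ⟨(addVertex_adj_of_le (ha.trans hst) (hb.trans hst)).2 h1, ha, hb⟩

theorem adj_iff (hG : IsProcess μ G' G) {s t : ℕ} (hs : v' ≤ s) (hst : s ≤ t) (ω : Ω) {a b : ℕ}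
    (ha : a ≤ s) (hb : b ≤ s) : (G t ω).Adj a b ↔ (G s ω).Adj a b := by
  rw [← hG.trunc_eq hs hst ω, trunc_adj]
  tauto

theorem limitGraph_adj (hG : IsProcess μ G' G) {s : ℕ} (hs : v' ≤ s) (ω : Ω) {a b : ℕ}
    (ha : a ≤ s) (hb : b ≤ s) : (limitGraph G ω).Adj a b ↔ (G s ω).Adj a b := by
  rw [limitGraph, SimpleGraph.iSup_adj]
  refine ⟨fun ⟨t, h⟩ => ?_, fun h => ⟨s, h⟩⟩
  rcases le_total s t with hst | hst
  · exact (hG.adj_iff hs hst ω ha hb).1 h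
  · rcases le_total v' t with hv | hv
    · rw [← hG.trunc_eq hv hst ω] at h
      exact h.1
    · rw [hG.init t hv ω, ← hG.init v' le_rfl ω, ← hG.trunc_eq le_rfl hs ω] at h
      exact h.1

theorem pastEvent_mono (hG : IsProcess μ G' G) {s t : ℕ} (hs : v' ≤ s) (hst : s ≤ t) {E : Set Ω}
    (hE : PastEvent G s E) : PastEvent G t E := by
  obtain ⟨A, rfl⟩ := hE
  refine ⟨trunc s ⁻¹' A, ?_⟩
  ext ω
  simp [hG.trunc_eq hs hst]

theorem measurableSet_eq (hG : IsProcess μ G' G) (t : ℕ) (H : SimpleGraph ℕ) :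
    MeasurableSet {ω | G t ω = H} := by
  have h : {ω | G t ω = H} = ⋂ a, ⋂ b, {ω | (G t ω).Adj a b ↔ H.Adj a b} := by
    ext ω
    simp only [Set.mem_ofPred_eq, Set.mem_iInter]
    exact ⟨fun h a b => by rw [h], fun h => by ext a b; exact h a b⟩
  rw [h]
  refine MeasurableSet.iInter fun a => MeasurableSet.iInter fun b => ?_
  by_cases hH : H.Adj a b
  · simpa [hH] using hG.measurable t a b
  · have h' : {ω | (G t ω).Adj a b ↔ H.Adj a b} = {ω | (G t ω).Adj a b}ᶜ := by
      ext ω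
      simp [hH]
    rw [h']
    exact (hG.measurable t a b).compl

theorem measurableSet_preimage (hG : IsProcess μ G' G) {t : ℕ} (ht : v' ≤ t)
    (A : Set (SimpleGraph ℕ)) : MeasurableSet (G t ⁻¹' A) := by
  have h : G t ⁻¹' A = ⋃ H ∈ {H | SupportedTo H t} ∩ A, {ω | G t ω = H} := by
    ext ω
    simp [hG.supportedTo ht ω]
  rw [h]
  exact MeasurableSet.biUnion ((finite_supportedTo t).inter_of_left A).countable
    fun H _ => hG.measurableSet_eq t H

theorem measurableSet_pastEvent (hG : IsProcess μ G' G) {t : ℕ} (ht : v' ≤ t) {E : Set Ω}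
    (hE : PastEvent G t E) : MeasurableSet E := by
  obtain ⟨A, rfl⟩ := hE
  exact hG.measurableSet_preimage ht A

variable [IsProbabilityMeasure μ]

theorem integrable_comp (hG : IsProcess μ G' G) {t : ℕ} (ht : v' ≤ t) (F : SimpleGraph ℕ → ℝ) :
    Integrable (fun ω => F (G t ω)) μ := by
  have hm : Measurable fun ω => F (G t ω) := fun s _ =>
    hG.measurableSet_preimage ht (F ⁻¹' s)
  refine Integrable.of_bound hm.aestronglyMeasurable
    (∑ H ∈ (finite_supportedTo t).toFinset, ‖F H‖) (Filter.Eventually.of_forall fun ω => ?_)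
  exact Finset.single_le_sum (f := fun H => ‖F H‖) (fun _ _ => norm_nonneg _)
    ((finite_supportedTo t).mem_toFinset.2 (hG.supportedTo ht ω))

/-- The one-step formula: conditionally on the past up to time `t`, the neighbourhood of the new
vertex is a random set with independent memberships, `u` being a member with probability
`deg (G t) u / t`. -/
theorem setIntegral_succ (hG : IsProcess μ G' G) {t : ℕ} (ht : v' ≤ t) {E : Set Ω}
    (hE : PastEvent G t E) (F : SimpleGraph ℕ → ℝ) :
    ∫ ω in E, F (G (t + 1) ω) ∂μ =
      ∫ ω in E, subsetMean (Finset.range (t + 1)) (fun u => (deg (G t ω) u : ℝ) / t)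
        (fun S => F (addVertex (G t ω) t S)) ∂μ := by
  classical
  have hEm := hG.measurableSet_pastEvent ht hE
  obtain ⟨A, rfl⟩ := hE
  set M : SimpleGraph ℕ → ℝ := fun H =>
    subsetMean (Finset.range (t + 1)) (fun u => (deg H u : ℝ) / t) (fun S => F (addVertex H t S))
  set I := (finite_supportedTo t).toFinset
  have hI : ∀ ω, G t ω ∈ I := fun ω => (finite_supportedTo t).mem_toFinset.2 (hG.supportedTo ht ω)
  have hmeas : ∀ H S, MeasurableSet {ω | G t ω = H ∧ G (t + 1) ω = addVertex H t S} := fun H S =>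
    (hG.measurableSet_eq t H).inter (hG.measurableSet_eq (t + 1) _)
  have hl : ∀ ω, (G t ⁻¹' A).indicator (fun ω => F (G (t + 1) ω)) ω =
      ∑ H ∈ I, ∑ S ∈ (Finset.range (t + 1)).powerset,
        {ω | G t ω = H ∧ G (t + 1) ω = addVertex H t S}.indicator
          (fun _ => if H ∈ A then F (addVertex H t S) else 0) ω := by
    intro ω
    obtain ⟨S₀, hS₀, h₀⟩ := hG.step t ht ω
    rw [Finset.sum_eq_single_of_mem (G t ω) (hI ω), Finset.sum_eq_single_of_mem S₀
      (Finset.mem_powerset.2 hS₀)]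
    · simp [Set.indicator_apply, h₀]
    · intro S hS hne
      refine Set.indicator_of_notMem (fun h => hne ?_) _
      have h1 : addVertex (G t ω) t S = addVertex (G t ω) t S₀ := h.2.symm.trans h₀
      ext b
      rw [← (hG.supportedTo ht ω).addVertex_adj_new (Finset.mem_powerset.1 hS), h1,
        (hG.supportedTo ht ω).addVertex_adj_new hS₀]
    · intro H _ hne
      exact Finset.sum_eq_zero fun S _ =>
        Set.indicator_of_notMem (fun h => hne h.1.symm) _
  have hr : ∀ ω, (G t ⁻¹' A).indicator (fun ω => M (G t ω)) ω =
      ∑ H ∈ I, {ω | G t ω = H}.indicator (fun _ => if H ∈ A then M H else 0) ω := by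
    intro ω
    rw [Finset.sum_eq_single_of_mem (G t ω) (hI ω)]
    · simp [Set.indicator_apply]
    · intro H _ hne
      simp [hne.symm]
  rw [← integral_indicator hEm, ← integral_indicator hEm, integral_congr_ae (.of_forall hl),
    integral_congr_ae (.of_forall hr), integral_finsetSum _ fun H _ =>
      (integrable_finsetSum _ fun S _ => (integrable_const _).indicator (hmeas H S)),
    integral_finsetSum _ fun H _ => (integrable_const _).indicator (hG.measurableSet_eq t H)]
  refine Finset.sum_congr rfl fun H _ => ?_
  rw [integral_finsetSum _ fun S _ => (integrable_const _).indicator (hmeas H S),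
    integral_indicator_const _ (hG.measurableSet_eq t H)]
  by_cases hHA : H ∈ A
  · by_cases hne : ∃ ω, G t ω = H
    · obtain ⟨ω, rfl⟩ := hne
      simp only [hHA, if_true, M, subsetMean, smul_eq_mul, Finset.mul_sum]
      refine Finset.sum_congr rfl fun S hS => ?_
      rw [integral_indicator_const _ (hmeas _ S), smul_eq_mul, measureReal_def, hG.transition t ht _ S
        (Finset.mem_powerset.1 hS), ENNReal.toReal_mul, ENNReal.toReal_ofReal, ← measureReal_def,
        mul_assoc]
      · rfl
      · refine Finset.prod_nonneg fun u hu => ?_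
        have h1 : (deg (G t ω) u : ℝ) / t ≤ 1 := div_le_one_of_le₀ (by
          exact_mod_cast (hG.supportedTo ht ω).deg_le (Nat.lt_succ_iff.1 (Finset.mem_range.1 hu)))
          (Nat.cast_nonneg _)
        have h2 : 0 ≤ (deg (G t ω) u : ℝ) / t := by positivity
        split_ifs <;> linarith
    · have h1 : {ω | G t ω = H} = ∅ := Set.eq_empty_iff_forall_notMem.2 fun ω h => hne ⟨ω, h⟩
      have h2 : ∀ S, {ω | G t ω = H ∧ G (t + 1) ω = addVertex H t S} = ∅ := fun S =>
        Set.eq_empty_iff_forall_notMem.2 fun ω h => hne ⟨ω, h.1⟩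
      simp [h1, h2]
  · simp [hHA]

end IsProcess

/-! ### Harmonic potentials and the extension property -/

/-- The potential `∑_{d ≤ i < t} 1 / i`, a proxy for `log (t / d)`. Along a Pólya urn, where `d`
increases by `1` at time `t` with probability `d / t`, it is a nonnegative martingale. -/
noncomputable def harmonicGap (d t : ℕ) : ℝ := ∑ i ∈ Finset.Ico d t, 1 / (i : ℝ)

theorem harmonicGap_nonneg (d t : ℕ) : 0 ≤ harmonicGap d t :=
  Finset.sum_nonneg fun i _ => by positivity

theorem harmonicGap_succ_right {d t : ℕ} (h : d ≤ t) :
    harmonicGap d (t + 1) = harmonicGap d t + 1 / t :=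
  Finset.sum_Ico_succ_top h _

theorem harmonicGap_succ_succ {d t : ℕ} (h : d ≤ t) :
    harmonicGap (d + 1) (t + 1) = harmonicGap d t + 1 / t - 1 / d := by
  rw [← harmonicGap_succ_right h, harmonicGap, harmonicGap,
    Finset.sum_eq_sum_Ico_succ_bot (Nat.lt_succ_of_le h)]
  ring

theorem exp_neg_harmonicGap_le {d t : ℕ} (hd : 0 < d) (h : d ≤ t) :
    Real.exp (-harmonicGap d t) ≤ d / t := by
  have hd' : (0 : ℝ) < d := by exact_mod_cast hd
  induction t, h using Nat.le_induction with
  | base => simp [harmonicGap, hd'.ne']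
  | succ t h ih =>
    have ht : (0 : ℝ) < t := by exact_mod_cast hd.trans_le h
    rw [harmonicGap_succ_right h, neg_add, Real.exp_add]
    have h1 : Real.exp (-(1 / (t : ℝ))) ≤ t / (t + 1) := by
      rw [Real.exp_neg, inv_le_comm₀ (Real.exp_pos _) (by positivity)]
      refine le_trans (le_of_eq ?_) (Real.add_one_le_exp _)
      field_simp
      ring
    calc _ ≤ (d : ℝ) / t * (t / (t + 1)) :=
          mul_le_mul ih h1 (Real.exp_pos _).le (by positivity)
      _ = _ := by push_cast; field_simp

section

variable {H : SimpleGraph ℕ} {t : ℕ}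

theorem SupportedTo.subsetMean_harmonicGap_deg (hH : SupportedTo H t) {v : ℕ} (hv : v ≤ t)
    (hd : 0 < deg H v) :
    subsetMean (Finset.range (t + 1)) (fun u => (deg H u : ℝ) / t)
      (fun S => harmonicGap (deg (addVertex H t S) v) (t + 1)) = harmonicGap (deg H v) t := by
  have hdt := hH.deg_le hv
  have hd' : (0 : ℝ) < deg H v := by exact_mod_cast hd
  rw [subsetMean_congr (ψ := fun S => (harmonicGap (deg H v) t + 1 / t) +
    (-(1 / (deg H v : ℝ))) * if v ∈ S then 1 else 0), subsetMean_add, subsetMean_const,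
    subsetMean_mul_left, subsetMean_mem (Finset.mem_range.2 (Nat.lt_succ_of_le hv))]
  · field_simp
    ring
  · intro S _
    rw [hH.deg_addVertex hv]
    split_ifs
    · rw [harmonicGap_succ_succ hdt]
      ring
    · rw [add_zero, harmonicGap_succ_right hdt]
      ring

theorem SupportedTo.subsetMean_harmonicGap_codeg (hH : SupportedTo H t) {u : ℕ} (hu : u ≤ t)
    (hd : deg H u < t) :
    subsetMean (Finset.range (t + 1)) (fun u => (deg H u : ℝ) / t)
      (fun S => harmonicGap (t + 1 - deg (addVertex H t S) u) (t + 1)) =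
        harmonicGap (t - deg H u) t := by
  obtain ⟨c, hc⟩ : ∃ c, t = deg H u + c := ⟨t - deg H u, by omega⟩
  have hc0 : (0 : ℝ) < c := by
    have : 0 < c := by omega
    exact_mod_cast this
  have ht0 : (0 : ℝ) < t := by
    have : 0 < t := by omega
    exact_mod_cast this
  have hct : c ≤ t := by omega
  have htc : (t : ℝ) = deg H u + c := by exact_mod_cast hc
  have htd : t - deg H u = c := by omega
  rw [subsetMean_congr (ψ := fun S => (harmonicGap c t + 1 / t - 1 / c) +
    (1 / (c : ℝ)) * if u ∈ S then 1 else 0), subsetMean_add, subsetMean_const,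
    subsetMean_mul_left, subsetMean_mem (Finset.mem_range.2 (Nat.lt_succ_of_le hu)), htd]
  · have : (deg H u : ℝ) = t - c := by linarith
    rw [this]
    field_simp
    ring
  · intro S _
    rw [hH.deg_addVertex hu]
    split_ifs
    · rw [show t + 1 - (deg H u + 1) = c by omega, harmonicGap_succ_right hct]
      ring
    · rw [show t + 1 - (deg H u + 0) = c + 1 by omega, harmonicGap_succ_succ hct]
      ring

/-- The sum of the harmonic potentials of the degrees of the members of `V` and of the codegrees of
the members of `U`. -/
noncomputable def patternGap (U V : Finset ℕ) (H : SimpleGraph ℕ) (t : ℕ) : ℝ :=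
  ∑ v ∈ V, harmonicGap (deg H v) t + ∑ u ∈ U, harmonicGap (t - deg H u) t

theorem patternGap_nonneg (U V : Finset ℕ) (H : SimpleGraph ℕ) (t : ℕ) : 0 ≤ patternGap U V H t :=
  add_nonneg (Finset.sum_nonneg fun _ _ => harmonicGap_nonneg _ _)
    (Finset.sum_nonneg fun _ _ => harmonicGap_nonneg _ _)

variable {U V : Finset ℕ}

theorem SupportedTo.subsetMean_patternGap (hH : SupportedTo H t) (hU : U ⊆ Finset.range (t + 1))
    (hV : V ⊆ Finset.range (t + 1)) (hV0 : ∀ v ∈ V, 0 < deg H v) (hUt : ∀ u ∈ U, deg H u < t) :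
    subsetMean (Finset.range (t + 1)) (fun u => (deg H u : ℝ) / t)
      (fun S => patternGap U V (addVertex H t S) (t + 1)) = patternGap U V H t := by
  have hle : ∀ {x}, x ∈ Finset.range (t + 1) → x ≤ t := fun h =>
    Nat.lt_succ_iff.1 (Finset.mem_range.1 h)
  simp only [patternGap]
  rw [subsetMean_add, subsetMean_sum, subsetMean_sum]
  congr 1
  · exact Finset.sum_congr rfl fun v hv =>
      hH.subsetMean_harmonicGap_deg (hle (hV hv)) (hV0 v hv)
  · exact Finset.sum_congr rfl fun u hu =>
      hH.subsetMean_harmonicGap_codeg (hle (hU hu)) (hUt u hu)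

theorem SupportedTo.exp_neg_patternGap_le (hH : SupportedTo H t) (hV : V ⊆ Finset.range (t + 1))
    (hV0 : ∀ v ∈ V, 0 < deg H v) (hUt : ∀ u ∈ U, deg H u < t) :
    Real.exp (-patternGap U V H t) ≤
      (∏ v ∈ V, (deg H v : ℝ) / t) * ∏ u ∈ U, (1 - (deg H u : ℝ) / t) := by
  rw [patternGap, neg_add, Real.exp_add, ← Finset.sum_neg_distrib, ← Finset.sum_neg_distrib,
    Real.exp_sum, Real.exp_sum]
  refine mul_le_mul (Finset.prod_le_prod (fun _ _ => (Real.exp_pos _).le) fun v hv =>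
      exp_neg_harmonicGap_le (hV0 v hv)
        (hH.deg_le (Nat.lt_succ_iff.1 (Finset.mem_range.1 (hV hv)))))
    (Finset.prod_le_prod (fun _ _ => (Real.exp_pos _).le) fun u hu => ?_)
    (Finset.prod_nonneg fun _ _ => (Real.exp_pos _).le)
    (Finset.prod_nonneg fun _ _ => by positivity)
  have h := hUt u hu
  refine (exp_neg_harmonicGap_le (Nat.sub_pos_of_lt h) (Nat.sub_le _ _)).trans (le_of_eq ?_)
  have ht0 : (t : ℝ) ≠ 0 := by
    have : t ≠ 0 := by omega
    exact_mod_cast this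
  rw [Nat.cast_sub h.le]
  field_simp

end

namespace IsProcess

variable {Ω : Type*} [MeasurableSpace Ω] {μ : Measure Ω} {v' : ℕ} {G' : SimpleGraph (Fin (v' + 1))}
  {G : ℕ → Ω → SimpleGraph ℕ}

theorem deg_succ_bounds (hG : IsProcess μ G' G) {t : ℕ} (ht : v' ≤ t) (ω : Ω) {u : ℕ}
    (hu : u ≤ t) :
    deg (G t ω) u ≤ deg (G (t + 1) ω) u ∧ deg (G (t + 1) ω) u ≤ deg (G t ω) u + 1 := by
  obtain ⟨S, -, h⟩ := hG.step t ht ω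
  rw [h, (hG.supportedTo ht ω).deg_addVertex hu]
  split_ifs <;> omega

theorem deg_mono (hG : IsProcess μ G' G) {s t : ℕ} (hs : v' ≤ s) (hst : s ≤ t) (ω : Ω) {u : ℕ}
    (hu : u ≤ s) : deg (G s ω) u ≤ deg (G t ω) u := by
  induction t, hst using Nat.le_induction with
  | base => exact le_rfl
  | succ t hst ih => exact ih.trans (hG.deg_succ_bounds (hs.trans hst) ω (hu.trans hst)).1

theorem deg_lt_of_le (hG : IsProcess μ G' G) {s t : ℕ} (hs : v' ≤ s) (hst : s ≤ t) (ω : Ω) {u : ℕ}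
    (hu : u ≤ s) (h : deg (G s ω) u < s) : deg (G t ω) u < t := by
  induction t, hst using Nat.le_induction with
  | base => exact h
  | succ t hst ih =>
    have := (hG.deg_succ_bounds (hs.trans hst) ω (hu.trans hst)).2
    omega

variable [IsProbabilityMeasure μ]

/-- Vertices which at time `t` are neither isolated (the members of `V`) nor joined to everything
(the members of `U`) almost surely satisfy an instance of the extension property. By the martingale
property the expected potential `L` stays bounded, and the conditional probability that the next
vertex is a witness is at least `exp (-L)`; so the probability that no witness has yet appeared
keeps decreasing by a fixed amount unless it tends to `0`. -/
theorem ae_exists_witness (hG : IsProcess μ G' G) {t : ℕ} (ht : v' ≤ t) {U V : Finset ℕ}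
    (hU : U ⊆ Finset.range (t + 1)) (hV : V ⊆ Finset.range (t + 1)) (hUV : Disjoint U V) :
    ∀ᵐ ω ∂μ, (∀ v ∈ V, 0 < deg (G t ω) v) → (∀ u ∈ U, deg (G t ω) u < t) →
      ∃ w > t, (∀ v ∈ V, (limitGraph G ω).Adj w v) ∧ ∀ u ∈ U, ¬ (limitGraph G ω).Adj w u := by
  classical
  have hle : ∀ {x}, x ∈ Finset.range (t + 1) → x ≤ t := fun h =>
    Nat.lt_succ_iff.1 (Finset.mem_range.1 h)
  set good : ℕ → SimpleGraph ℕ → Prop := fun w K => (∀ v ∈ V, K.Adj w v) ∧ ∀ u ∈ U, ¬ K.Adj w u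
  set E₀ : Set Ω := {ω | (∀ v ∈ V, 0 < deg (G t ω) v) ∧ ∀ u ∈ U, deg (G t ω) u < t}
  set E : ℕ → Set Ω := fun T => E₀ ∩ {ω | ∀ w, t < w → w ≤ T → ¬ good w (G T ω)}
  have hgood : ∀ {s T : ℕ} (ω : Ω) {w : ℕ}, t < w → w ≤ s → s ≤ T →
      (good w (G T ω) ↔ good w (G s ω)) := by
    intro s T ω w hw hws hsT
    have hs : t ≤ s := hw.le.trans hws
    have h : ∀ x ∈ Finset.range (t + 1), ((G T ω).Adj w x ↔ (G s ω).Adj w x) := fun x hx =>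
      hG.adj_iff (ht.trans hs) hsT ω hws ((hle hx).trans hs)
    exact and_congr (forall₂_congr fun v hv => h v (hV hv))
      (forall₂_congr fun u hu => not_congr (h u (hU hu)))
  have hE₀ : PastEvent G t E₀ := ⟨{H | (∀ v ∈ V, 0 < deg H v) ∧ ∀ u ∈ U, deg H u < t}, rfl⟩
  have hE₀' : ∀ T, t ≤ T → ∀ ω ∈ E₀,
      (∀ v ∈ V, 0 < deg (G T ω) v) ∧ ∀ u ∈ U, deg (G T ω) u < T := fun T hT ω hω =>
    ⟨fun v hv => (hω.1 v hv).trans_le (hG.deg_mono ht hT ω (hle (hV hv))),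
      fun u hu => hG.deg_lt_of_le ht hT ω (hle (hU hu)) (hω.2 u hu)⟩
  have hE : ∀ T, t ≤ T → PastEvent G T (E T) := fun T hT =>
    (hG.pastEvent_mono ht hT hE₀).inter ⟨{K | ∀ w, t < w → w ≤ T → ¬ good w K}, rfl⟩
  have hEsucc : ∀ T, t ≤ T → E (T + 1) = E T ∩ {ω | ¬ good (T + 1) (G (T + 1) ω)} := by
    intro T hT
    ext ω
    constructor
    · rintro ⟨h0, h⟩
      exact ⟨⟨h0, fun w hw hwT hg => h w hw (by omega) ((hgood ω hw hwT (Nat.le_succ T)).2 hg)⟩,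
        h (T + 1) (by omega) le_rfl⟩
    · rintro ⟨⟨h0, h⟩, h1⟩
      refine ⟨h0, fun w hw hwT hg => ?_⟩
      rcases Nat.lt_or_ge T w with hlt | hge
      · obtain rfl : w = T + 1 := by omega
        exact h1 hg
      · exact h w hw hge ((hgood ω hw hge (Nat.le_succ T)).1 hg)
  have hmE : ∀ T, t ≤ T → MeasurableSet (E T) := fun T hT =>
    hG.measurableSet_pastEvent (ht.trans hT) (hE T hT)
  have hmE₀ : MeasurableSet E₀ := hG.measurableSet_pastEvent ht hE₀
  -- the potential has constant expectation on `E₀`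
  set C : ℝ := ∫ ω in E₀, patternGap U V (G t ω) t ∂μ
  have hsub : ∀ {T}, t ≤ T → Finset.range (t + 1) ⊆ Finset.range (T + 1) := fun h =>
    Finset.range_subset_range.2 (Nat.succ_le_succ h)
  have hC : ∀ T, t ≤ T → ∫ ω in E₀, patternGap U V (G T ω) T ∂μ = C := by
    intro T hT
    induction T, hT using Nat.le_induction with
    | base => rfl
    | succ T hT ih =>
      rw [hG.setIntegral_succ (ht.trans hT) (hG.pastEvent_mono ht hT hE₀)
        (fun H => patternGap U V H (T + 1)), ← ih]
      refine setIntegral_congr_fun hmE₀ fun ω hω => ?_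
      show subsetMean _ _ _ = _
      exact (hG.supportedTo (ht.trans hT) ω).subsetMean_patternGap (hU.trans (hsub hT))
        (hV.trans (hsub hT)) (hE₀' T hT ω hω).1 (hE₀' T hT ω hω).2
  have hCE : ∀ T, t ≤ T → ∫ ω in E T, patternGap U V (G T ω) T ∂μ ≤ C := by
    intro T hT
    rw [← hC T hT]
    exact setIntegral_mono_set (hG.integrable_comp (ht.trans hT) fun H =>
      patternGap U V H T).integrableOn (.of_forall fun ω => patternGap_nonneg U V _ T)
      (Set.inter_subset_left).eventuallyLE
  -- the one-step recursion for the probability that there is no witness yet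
  have hstep : ∀ T, t ≤ T → μ.real (E (T + 1)) ≤
      μ.real (E T) - ∫ ω in E T, Real.exp (-patternGap U V (G T ω) T) ∂μ := by
    intro T hT
    set F : SimpleGraph ℕ → ℝ := fun K => if good (T + 1) K then 0 else 1
    have h1 : μ.real (E (T + 1)) = ∫ ω in E T, F (G (T + 1) ω) ∂μ := by
      have hm : MeasurableSet {ω | ¬ good (T + 1) (G (T + 1) ω)} :=
        hG.measurableSet_preimage (by omega) {K | ¬ good (T + 1) K}
      have : ∀ ω, F (G (T + 1) ω) =
          {ω | ¬ good (T + 1) (G (T + 1) ω)}.indicator (fun _ => 1) ω := by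
        intro ω
        simp only [F, Set.indicator_apply, Set.mem_ofPred_eq]
        split_ifs <;> simp_all
      simp only [this]
      rw [setIntegral_indicator hm, ← hEsucc T hT]
      simp
    rw [h1, hG.setIntegral_succ (ht.trans hT) (hE T hT) F]
    have h2 : μ.real (E T) = ∫ ω in E T, (1 : ℝ) ∂μ := by simp
    have hi1 : IntegrableOn (fun ω => Real.exp (-patternGap U V (G T ω) T)) (E T) μ :=
      (hG.integrable_comp (ht.trans hT) fun H => Real.exp (-patternGap U V H T)).integrableOn
    have hi2 : IntegrableOn (fun ω => subsetMean (Finset.range (T + 1))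
        (fun u => (deg (G T ω) u : ℝ) / T)
        fun S => F (addVertex (G T ω) T S))
        (E T) μ :=
      (hG.integrable_comp (ht.trans hT) fun H => subsetMean (Finset.range (T + 1))
        (fun u => (deg H u : ℝ) / T)
        fun S => F (addVertex H T S)).integrableOn
    rw [h2, ← integral_sub (integrable_const _) hi1]
    refine setIntegral_mono_on hi2 ((integrable_const _).sub hi1) (hmE T hT) fun ω hω => ?_
    have hs := hG.supportedTo (ht.trans hT) ω
    obtain ⟨hV0, hUt⟩ := hE₀' T hT ω hω.1
    have h3 := hs.exp_neg_patternGap_le (hV.trans (hsub hT)) hV0 hUt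
    rw [← subsetMean_pattern (hU.trans (hsub hT)) (hV.trans (hsub hT)) hUV] at h3
    have h4 : subsetMean (Finset.range (T + 1)) (fun u => (deg (G T ω) u : ℝ) / T)
        (fun S => F (addVertex (G T ω) T S)) +
        subsetMean (Finset.range (T + 1)) (fun u => (deg (G T ω) u : ℝ) / T)
        (fun S => if V ⊆ S ∧ Disjoint U S then 1 else 0) = 1 := by
      rw [← subsetMean_add]
      refine (subsetMean_congr (ψ := fun _ => 1) fun S hS => ?_).trans subsetMean_one
      have : good (T + 1) (addVertex (G T ω) T S) ↔ V ⊆ S ∧ Disjoint U S := by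
        simp only [good, hs.addVertex_adj_new hS, Finset.disjoint_left]
        rfl
      simp only [F, this]
      split_ifs <;> simp
    linarith
  -- hence the event that there never is a witness is null
  have hnull : μ.real (⋂ n, E (t + n)) = 0 := by
    by_contra hne
    set c := μ.real (⋂ n, E (t + n))
    have hc : 0 < c := lt_of_le_of_ne measureReal_nonneg (Ne.symm hne)
    have hcE : ∀ n, c ≤ μ.real (E (t + n)) := fun n => measureReal_mono (Set.iInter_subset _ n)
    set K := C / c
    have hbound : ∀ n, Real.exp (-K) * c ≤
        ∫ ω in E (t + n), Real.exp (-patternGap U V (G (t + n) ω) (t + n)) ∂μ := by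
      intro n
      have hT : t ≤ t + n := Nat.le_add_right t n
      have hi := hG.integrable_comp (ht.trans hT) (fun H => patternGap U V H (t + n))
      -- the tangent line at `K` bounds the convex function `exp (-x)` from below
      have h1 : ∫ ω in E (t + n),
          Real.exp (-K) * ((1 + K) - patternGap U V (G (t + n) ω) (t + n)) ∂μ ≤
          ∫ ω in E (t + n), Real.exp (-patternGap U V (G (t + n) ω) (t + n)) ∂μ := by
        refine setIntegral_mono (((integrable_const _).sub hi.integrableOn).const_mul _)
          (hG.integrable_comp (ht.trans hT) fun H =>
            Real.exp (-patternGap U V H (t + n))).integrableOn fun ω => ?_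
        have := Real.add_one_le_exp (K - patternGap U V (G (t + n) ω) (t + n))
        calc _ ≤ Real.exp (-K) * Real.exp (K - patternGap U V (G (t + n) ω) (t + n)) :=
              mul_le_mul_of_nonneg_left (by linarith) (Real.exp_pos _).le
          _ = _ := by rw [← Real.exp_add]; congr 1; ring
      refine le_trans ?_ h1
      rw [integral_const_mul, integral_sub (integrable_const _) hi.integrableOn]
      refine mul_le_mul_of_nonneg_left ?_ (Real.exp_pos _).le
      have h2 := hCE (t + n) hT
      have hKc : K * c = C := div_mul_cancel₀ C hc.ne'
      have hK : 0 ≤ K := div_nonneg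
        (setIntegral_nonneg hmE₀ fun ω _ => patternGap_nonneg U V _ t) hc.le
      simp only [integral_const, MeasurableSet.univ, measureReal_restrict_apply, Set.univ_inter,
        smul_eq_mul]
      nlinarith [hcE n]
    have hdec : ∀ n : ℕ, μ.real (E (t + n)) ≤ 1 - n * (Real.exp (-K) * c) := by
      intro n
      induction n with
      | zero => simp
      | succ n ih =>
        have := hstep (t + n) (Nat.le_add_right t n)
        have := hbound n
        rw [← add_assoc]
        push_cast
        linarith
    obtain ⟨n, hn⟩ := exists_nat_gt (1 / (Real.exp (-K) * c))
    have hpos : 0 < Real.exp (-K) * c := mul_pos (Real.exp_pos _) hc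
    rw [div_lt_iff₀ hpos] at hn
    linarith [hdec n, hcE n]
  have hnull' : μ (⋂ n, E (t + n)) = 0 := (measureReal_eq_zero_iff).1 hnull
  filter_upwards [measure_eq_zero_iff_ae_notMem.1 hnull'] with ω hω hV0 hUt
  simp only [Set.mem_iInter, not_forall] at hω
  obtain ⟨n, hn⟩ := hω
  have hn' : ¬ ∀ w, t < w → w ≤ t + n → ¬ good w (G (t + n) ω) := fun h => hn ⟨⟨hV0, hUt⟩, h⟩
  push Not at hn'
  obtain ⟨w, hw, hwn, hg⟩ := hn'
  have hlim : ∀ x ∈ Finset.range (t + 1),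
      ((limitGraph G ω).Adj w x ↔ (G (t + n) ω).Adj w x) := fun x hx =>
    hG.limitGraph_adj (by omega) ω hwn ((hle hx).trans (by omega))
  exact ⟨w, hw, fun v hv => (hlim v (hV hv)).2 (hg.1 v hv),
    fun u hu h => hg.2 u hu ((hlim u (hU hu)).1 h)⟩

end IsProcess

/-! ### Growth of the number of edges and isolated vertices -/

section

variable {H : SimpleGraph ℕ} {t : ℕ}

theorem sum_deg_div : ∑ u ∈ Finset.range (t + 1), (deg H u : ℝ) / t = degSum H t / t := by
  rw [← Finset.sum_div, degSum]
  push_cast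
  rfl

theorem SupportedTo.deg_div_mem (hH : SupportedTo H t) :
    ∀ u ∈ Finset.range (t + 1), 0 ≤ (deg H u : ℝ) / t ∧ (deg H u : ℝ) / t ≤ 1 := fun u hu =>
  ⟨by positivity, div_le_one_of_le₀ (by
    exact_mod_cast hH.deg_le (Nat.lt_succ_iff.1 (Finset.mem_range.1 hu))) (Nat.cast_nonneg _)⟩

/-- The potential `t³ / D²`, with `D` the sum of the degrees, has negative drift once `D` and `t`
are not too small: `D` grows like `t²`. -/
theorem SupportedTo.subsetMean_potential_le (hH : SupportedTo H t) (ht : 100 ≤ t)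
    (hD : 48 ≤ degSum H t) :
    subsetMean (Finset.range (t + 1)) (fun u => (deg H u : ℝ) / t)
      (fun S => ((t + 1 : ℕ) : ℝ) ^ 3 / (degSum (addVertex H t S) (t + 1) : ℝ) ^ 2) ≤
      (t : ℝ) ^ 3 / (degSum H t : ℝ) ^ 2 * (1 - 1 / (2 * t)) := by
  have hD' : (48 : ℝ) ≤ (degSum H t : ℝ) := by exact_mod_cast hD
  set D := (degSum H t : ℝ)
  have hD0 : 0 < D := by linarith
  have ht' : (100 : ℝ) ≤ t := by exact_mod_cast ht
  have ht0 : (0 : ℝ) < t := by linarith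
  set c : ℝ := ((t + 1 : ℕ) : ℝ) ^ 3 / D ^ 2
  have hc : 0 ≤ c := by positivity
  -- `(1 + x)⁻² ≤ 1 - 2 x + 3 x²` for `x ≥ 0`, applied with `x = 2 |S| / D`
  have hpt : ∀ S ⊆ Finset.range (t + 1),
      ((t + 1 : ℕ) : ℝ) ^ 3 / (degSum (addVertex H t S) (t + 1) : ℝ) ^ 2 ≤
        c * (1 + ((-4 / D) * (S.card : ℝ) + (12 / D ^ 2) * (S.card : ℝ) ^ 2)) := by
    intro S hS
    rw [hH.degSum_addVertex hS]
    push_cast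
    set x : ℝ := 2 * (S.card : ℝ) / D
    have hx : 0 ≤ x := by positivity
    have h1 : (degSum H t : ℝ) + 2 * (S.card : ℝ) = D * (1 + x) := by
      simp only [x, D]
      field_simp
    have h2 : 1 + ((-4 / D) * (S.card : ℝ) + (12 / D ^ 2) * (S.card : ℝ) ^ 2) =
        1 - 2 * x + 3 * x ^ 2 := by
      simp only [x]
      field_simp
      ring
    have h3 : 1 / (1 + x) ^ 2 ≤ 1 - 2 * x + 3 * x ^ 2 := by
      rw [div_le_iff₀ (by positivity)]
      nlinarith [pow_nonneg hx 3, pow_nonneg hx 4]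
    rw [h1, h2, mul_pow]
    refine le_trans (le_of_eq ?_) (mul_le_mul_of_nonneg_left h3 hc)
    simp only [c]
    push_cast
    field_simp
  refine (subsetMean_mono hH.deg_div_mem hpt).trans ?_
  rw [subsetMean_mul_left, subsetMean_add, subsetMean_add, subsetMean_one, subsetMean_mul_left,
    subsetMean_mul_left, subsetMean_card, sum_deg_div]
  have hsq := subsetMean_card_sq_le (fun u hu => (hH.deg_div_mem u hu).1)
  rw [sum_deg_div] at hsq
  have h4 : 12 / D ^ 2 * subsetMean (Finset.range (t + 1)) (fun u => (deg H u : ℝ) / t)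
      (fun S => (S.card : ℝ) ^ 2) ≤ 12 / (t : ℝ) ^ 2 + 1 / (4 * t) := by
    refine (mul_le_mul_of_nonneg_left hsq (by positivity)).trans ?_
    have : 12 / D ^ 2 * ((D / t) ^ 2 + D / t) = 12 / (t : ℝ) ^ 2 + 12 / D * (1 / t) := by
      field_simp
    rw [this]
    have h5 : 12 / D ≤ 1 / 4 := by
      rw [div_le_iff₀ hD0]
      linarith
    have h6 : 12 / D * (1 / t) ≤ 1 / 4 * (1 / t) := mul_le_mul_of_nonneg_right h5 (by positivity)
    have h7 : (1 : ℝ) / (4 * t) = 1 / 4 * (1 / t) := by field_simp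
    linarith
  have h8 : -4 / D * (D / t) = -4 / t := by field_simp
  calc _ ≤ c * (1 + (-4 / t + (12 / (t : ℝ) ^ 2 + 1 / (4 * t)))) := by
        refine mul_le_mul_of_nonneg_left ?_ hc
        have : (degSum H t : ℝ) = D := rfl
        rw [this, h8]
        linarith
    _ ≤ _ := by
        simp only [c]
        push_cast
        rw [div_mul_eq_mul_div, div_mul_eq_mul_div]
        refine div_le_div_of_nonneg_right ?_ (by positivity)
        obtain ⟨s, hs, hst⟩ : ∃ s : ℝ, 0 ≤ s ∧ (t : ℝ) = s + 100 := ⟨t - 100, by linarith, by ring⟩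
        have h9 : ((t : ℝ) + 1) ^ 3 * (1 + (-4 / t + (12 / (t : ℝ) ^ 2 + 1 / (4 * t)))) =
            ((t : ℝ) + 1) ^ 3 * (t ^ 2 - 15 / 4 * t + 12) / t ^ 2 := by
          field_simp
          ring
        have h10 : (t : ℝ) ^ 3 * (1 - 1 / (2 * t)) = (t ^ 5 - t ^ 4 / 2) / t ^ 2 := by
          field_simp
        rw [h9, h10]
        refine div_le_div_of_nonneg_right ?_ (by positivity)
        rw [hst, ← sub_nonneg]
        ring_nf
        positivity

/-- The probability that the next vertex is isolated is small compared to the potential, by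
`∏ (1 - x_u) ≤ exp (-∑ x_u)` and `exp (-x) ≤ 2 / x²`. -/
theorem SupportedTo.prod_one_sub_le (hH : SupportedTo H t) (ht : 0 < t) (hD : 0 < degSum H t) :
    ∏ u ∈ Finset.range (t + 1), (1 - (deg H u : ℝ) / t) ≤
      2 / t * ((t : ℝ) ^ 3 / (degSum H t : ℝ) ^ 2) := by
  have ht' : (0 : ℝ) < t := by exact_mod_cast ht
  have hD' : (0 : ℝ) < degSum H t := by exact_mod_cast hD
  set x : ℝ := degSum H t / t
  have hx : 0 < x := by positivity
  have h1 : ∏ u ∈ Finset.range (t + 1), (1 - (deg H u : ℝ) / t) ≤ Real.exp (-x) := by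
    simp only [x]
    rw [← sum_deg_div, ← Finset.sum_neg_distrib, Real.exp_sum]
    refine Finset.prod_le_prod (fun u hu => ?_) fun u _ => Real.one_sub_le_exp_neg _
    linarith [(hH.deg_div_mem u hu).2]
  have h2 : Real.exp (-x) ≤ 2 / x ^ 2 := by
    rw [Real.exp_neg, inv_le_comm₀ (Real.exp_pos _) (by positivity), inv_div]
    linarith [Real.quadratic_le_exp_of_nonneg hx.le]
  refine (h1.trans h2).trans (le_of_eq ?_)
  simp only [x]
  field_simp

end

theorem deg_eq_zero_of_limitGraph {Ω : Type*} {G : ℕ → Ω → SimpleGraph ℕ} {t : ℕ} {ω : Ω} {v : ℕ}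
    (h : ∀ w, ¬ (limitGraph G ω).Adj v w) : deg (G t ω) v = 0 := by
  have : (G t ω).neighborSet v = ∅ := Set.eq_empty_iff_forall_notMem.2 fun w hw =>
    h w ((le_iSup (fun t => G t ω) t) hw)
  rw [deg, this, Set.ncard_empty]

namespace IsProcess

variable {Ω : Type*} [MeasurableSpace Ω] {μ : Measure Ω} {v' : ℕ} {G' : SimpleGraph (Fin (v' + 1))}
  {G : ℕ → Ω → SimpleGraph ℕ}

theorem degSum_mono (hG : IsProcess μ G' G) {s t : ℕ} (hs : v' ≤ s) (hst : s ≤ t) (ω : Ω) :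
    degSum (G s ω) s ≤ degSum (G t ω) t := by
  induction t, hst using Nat.le_induction with
  | base => exact le_rfl
  | succ t hst ih =>
    obtain ⟨S, hS, h⟩ := hG.step t (hs.trans hst) ω
    rw [h, (hG.supportedTo (hs.trans hst) ω).degSum_addVertex hS]
    omega

variable [IsProbabilityMeasure μ]

/-- Once there are enough edges, the expected number of further vertices which are isolated at
their birth is finite: the probability that the next vertex is isolated is bounded by the
expected decrease of the potential `t³ / D²`. -/
theorem ae_finite_isolated_of_degSum (hG : IsProcess μ G' G) {t : ℕ} (ht : v' ≤ t)
    (ht100 : 100 ≤ t) :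
    ∀ᵐ ω ∂μ, 48 ≤ degSum (G t ω) t → {v | ∀ w, ¬ (limitGraph G ω).Adj v w}.Finite := by
  classical
  set E : Set Ω := {ω | 48 ≤ degSum (G t ω) t}
  have hE : PastEvent G t E := ⟨{H | 48 ≤ degSum H t}, rfl⟩
  have hmE : MeasurableSet E := hG.measurableSet_pastEvent ht hE
  set ψ : ℕ → SimpleGraph ℕ → ℝ := fun T H => (T : ℝ) ^ 3 / (degSum H T : ℝ) ^ 2
  set a : ℕ → ℝ := fun T => ∫ ω in E, ψ T (G T ω) ∂μ
  have hψ : ∀ T H, 0 ≤ ψ T H := fun T H => by positivity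
  have hdec : ∀ T, t ≤ T → a (T + 1) ≤ a T - a T / (2 * T) := by
    intro T hT
    have hi := (hG.integrable_comp (ht.trans hT) (ψ T)).integrableOn (s := E)
    have h1 : a (T + 1) ≤ ∫ ω in E, ψ T (G T ω) * (1 - 1 / (2 * T)) ∂μ := by
      simp only [a]
      rw [hG.setIntegral_succ (ht.trans hT) (hG.pastEvent_mono ht hT hE) (ψ (T + 1))]
      refine setIntegral_mono_on (hG.integrable_comp (ht.trans hT) fun H =>
        subsetMean (Finset.range (T + 1)) (fun u => (deg H u : ℝ) / T)
          fun S => ψ (T + 1) (addVertex H T S)).integrableOn (hi.mul_const _) hmE fun ω hω => ?_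
      exact (hG.supportedTo (ht.trans hT) ω).subsetMean_potential_le (ht100.trans hT)
        (le_trans hω (hG.degSum_mono ht hT ω))
    rw [integral_mul_const] at h1
    refine h1.trans (le_of_eq ?_)
    simp only [a]
    ring
  set B : ℕ → Set Ω := fun T => E ∩ {ω | deg (G (T + 1) ω) (T + 1) = 0}
  have hB : ∀ T, t ≤ T → μ.real (B T) ≤ 4 * (a T - a (T + 1)) := by
    intro T hT
    have hT0 : (0 : ℝ) < T := by
      have : 0 < T := by omega
      exact_mod_cast this
    set F : SimpleGraph ℕ → ℝ := fun K => if deg K (T + 1) = 0 then 1 else 0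
    have h1 : μ.real (B T) = ∫ ω in E, F (G (T + 1) ω) ∂μ := by
      have hm : MeasurableSet {ω | deg (G (T + 1) ω) (T + 1) = 0} :=
        hG.measurableSet_preimage (by omega) {K | deg K (T + 1) = 0}
      have : ∀ ω, F (G (T + 1) ω) =
          {ω | deg (G (T + 1) ω) (T + 1) = 0}.indicator (fun _ => 1) ω := by
        intro ω
        simp only [F, Set.indicator_apply, Set.mem_ofPred_eq]
      simp only [this]
      rw [setIntegral_indicator hm]
      simp [B]
    have hi := (hG.integrable_comp (ht.trans hT) (ψ T)).integrableOn (s := E)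
    have h2 : μ.real (B T) ≤ ∫ ω in E, 2 / T * ψ T (G T ω) ∂μ := by
      rw [h1, hG.setIntegral_succ (ht.trans hT) (hG.pastEvent_mono ht hT hE) F]
      refine setIntegral_mono_on (hG.integrable_comp (ht.trans hT) fun H =>
        subsetMean (Finset.range (T + 1)) (fun u => (deg H u : ℝ) / T)
          fun S => F (addVertex H T S)).integrableOn (hi.const_mul _) hmE fun ω hω => ?_
      have hs := hG.supportedTo (ht.trans hT) ω
      have hD : 48 ≤ degSum (G T ω) T := le_trans hω (hG.degSum_mono ht hT ω)
      refine le_trans (le_of_eq ?_) (hs.prod_one_sub_le (by omega) (by omega))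
      rw [← subsetMean_empty]
      refine subsetMean_congr fun S hS => ?_
      simp only [F, hs.deg_addVertex_new hS, Finset.card_eq_zero]
    rw [integral_const_mul] at h2
    have h3 := hdec T hT
    have h4 : 2 / (T : ℝ) * a T = 4 * (a T / (2 * T)) := by
      field_simp
      ring
    have h5 : 2 / (T : ℝ) * a T = 2 / T * ∫ ω in E, ψ T (G T ω) ∂μ := rfl
    linarith
  have ha : ∀ T, 0 ≤ a T := fun T => setIntegral_nonneg hmE fun ω _ => hψ T _
  have hsum : ∀ n, ∑ i ∈ Finset.range n, μ (B (t + i)) ≤ ENNReal.ofReal (4 * a t) := by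
    intro n
    have h1 : ∑ i ∈ Finset.range n, μ.real (B (t + i)) ≤ 4 * (a t - a (t + n)) := by
      induction n with
      | zero => simp
      | succ n ih =>
        rw [Finset.sum_range_succ, ← add_assoc]
        linarith [hB (t + n) (Nat.le_add_right t n)]
    have h2 : ∑ i ∈ Finset.range n, μ (B (t + i)) =
        ENNReal.ofReal (∑ i ∈ Finset.range n, μ.real (B (t + i))) := by
      rw [ENNReal.ofReal_sum_of_nonneg fun _ _ => measureReal_nonneg]
      exact Finset.sum_congr rfl fun i _ => (ofReal_measureReal).symm
    rw [h2]
    exact ENNReal.ofReal_le_ofReal (by linarith [ha (t + n)])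
  have htsum : ∑' i, μ (B (t + i)) ≠ ⊤ :=
    ne_top_of_le_ne_top ENNReal.ofReal_ne_top (ENNReal.tsum_le_of_sum_range_le hsum)
  filter_upwards [ae_eventually_notMem htsum] with ω hω hE
  obtain ⟨N, hN⟩ := Filter.eventually_atTop.1 hω
  refine (Set.finite_le_nat (t + N)).subset fun v hv => ?_
  change v ≤ t + N
  by_contra hlt
  obtain ⟨n, rfl⟩ : ∃ n, v = t + n + 1 := ⟨v - t - 1, by omega⟩
  exact hN n (by omega) ⟨hE, deg_eq_zero_of_limitGraph hv⟩

/-- Started from a graph with an edge, the process almost surely eventually has arbitrarily many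
edges, since an endpoint of that edge gets infinitely many neighbours. -/
theorem ae_exists_le_degSum (hG : IsProcess μ G' G) (hne : G' ≠ ⊥) (k : ℕ) :
    ∀ᵐ ω ∂μ, ∃ t, v' ≤ t ∧ k ≤ t ∧ k ≤ degSum (G t ω) t := by
  obtain ⟨x, y, hxy⟩ := SimpleGraph.ne_bot_iff_exists_adj.1 hne
  set v := (x : ℕ)
  have hv : v ≤ v' := Nat.lt_succ_iff.1 x.2
  have hpos : ∀ t, v' ≤ t → ∀ ω, 0 < deg (G t ω) v := by
    intro t ht ω
    refine lt_of_lt_of_le ?_ (hG.deg_mono le_rfl ht ω hv)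
    refine (Set.ncard_pos ((hG.supportedTo le_rfl ω).finite_neighborSet v)).2 ⟨y, ?_⟩
    rw [SimpleGraph.mem_neighborSet, hG.init v' le_rfl ω]
    exact (SimpleGraph.map_adj _ _ _ _).2 ⟨x, y, hxy, rfl, rfl⟩
  have hw : ∀ᵐ ω ∂μ, ∀ t, v' ≤ t → ∃ w > t, (limitGraph G ω).Adj w v := by
    rw [ae_all_iff]
    intro t
    by_cases ht : v' ≤ t
    · filter_upwards [hG.ae_exists_witness ht (U := ∅) (V := {v}) (Finset.empty_subset _)
        (Finset.singleton_subset_iff.2 (Finset.mem_range.2 (by omega)))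
        (Finset.disjoint_empty_left _)] with ω h _
      obtain ⟨w, hw, h1, -⟩ := h (by simpa using hpos t ht ω) (by simp)
      exact ⟨w, hw, h1 v (Finset.mem_singleton_self v)⟩
    · exact .of_forall fun ω h => absurd h ht
  filter_upwards [hw] with ω hω
  have hinf : {w | (limitGraph G ω).Adj w v}.Infinite := by
    refine Set.infinite_of_not_bddAbove fun ⟨b, hb⟩ => ?_
    obtain ⟨w, hw, hadj⟩ := hω (max v' b) (le_max_left _ _)
    exact absurd (hb hadj) (not_le.2 ((le_max_right _ _).trans_lt hw))
  obtain ⟨A, hA, hcard⟩ := hinf.exists_subset_card_eq k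
  set t := max (max v' k) (A.sup id)
  have ht : v' ≤ t := (le_max_left _ _).trans (le_max_left _ _)
  refine ⟨t, ht, (le_max_right _ _).trans (le_max_left _ _), ?_⟩
  have h1 : k ≤ deg (G t ω) v := by
    rw [← hcard, ← Set.ncard_coe_finset, deg]
    refine Set.ncard_le_ncard (fun w hwA => ?_) ((hG.supportedTo ht ω).finite_neighborSet v)
    have hwt : w ≤ t := (Finset.le_sup (f := id) hwA).trans (le_max_right _ _)
    exact ((hG.limitGraph_adj ht ω hwt (hv.trans ht)).1 (hA hwA)).symm
  exact h1.trans (Finset.single_le_sum (f := fun u => deg (G t ω) u) (fun _ _ => Nat.zero_le _)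
    (Finset.mem_range.2 (by omega)))

theorem ae_finite_isolated (hG : IsProcess μ G' G) (hne : G' ≠ ⊥) :
    ∀ᵐ ω ∂μ, {v | ∀ w, ¬ (limitGraph G ω).Adj v w}.Finite := by
  have h : ∀ᵐ ω ∂μ, ∀ t, v' ≤ t → 100 ≤ t → 48 ≤ degSum (G t ω) t →
      {v | ∀ w, ¬ (limitGraph G ω).Adj v w}.Finite := by
    rw [ae_all_iff]
    intro t
    by_cases ht : v' ≤ t ∧ 100 ≤ t
    · filter_upwards [hG.ae_finite_isolated_of_degSum ht.1 ht.2] with ω hω _ _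
      exact hω
    · exact .of_forall fun ω h1 h2 => absurd ⟨h1, h2⟩ ht
  filter_upwards [h, hG.ae_exists_le_degSum hne 100] with ω hω ⟨t, ht, h100, hD⟩
  exact hω t ht h100 (le_trans (by norm_num) hD)

end IsProcess

/-! ### Uniqueness of the Rado graph and the structure of the limit -/

/-- A finite partial isomorphism between two graphs, encoded as the finite set of the pairs of
corresponding vertices. -/
def PartialGraphIso {α β : Type*} (R : SimpleGraph α) (Q : SimpleGraph β) : Type _ :=
  { f : Finset (α × β) // ∀ p ∈ f, ∀ q ∈ f,
    (p.1 = q.1 ↔ p.2 = q.2) ∧ (R.Adj p.1 q.1 ↔ Q.Adj p.2 q.2) }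

namespace PartialGraphIso

variable {α β : Type*} {R : SimpleGraph α} {Q : SimpleGraph β}

instance : Preorder (PartialGraphIso R Q) := Preorder.lift Subtype.val

instance : Inhabited (PartialGraphIso R Q) := ⟨⟨∅, by simp⟩⟩

theorem exists_extension_left (hQ : IsRadoGraph Q) (f : PartialGraphIso R Q) (a : α) :
    ∃ g : PartialGraphIso R Q, (∃ b, (a, b) ∈ g.val) ∧ f ≤ g := by
  classical
  by_cases h : ∃ b, (a, b) ∈ f.val
  · exact ⟨f, h, le_rfl⟩
  obtain ⟨f, hf⟩ := f
  obtain ⟨b, hbU, hbV, hV, hU⟩ := hQ.extension ({p ∈ f | ¬ R.Adj a p.1}.image Prod.snd)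
    ({p ∈ f | R.Adj a p.1}.image Prod.snd) (by
      rw [Finset.disjoint_left]
      intro y hy hy'
      obtain ⟨p, hp, rfl⟩ := Finset.mem_image.1 hy
      obtain ⟨q, hq, hqp⟩ := Finset.mem_image.1 hy'
      rw [Finset.mem_filter] at hp hq
      have := (hf q hq.1 p hp.1).1.2 hqp
      rw [← this] at hp
      exact hp.2 hq.2)
  have hnew : ∀ p ∈ f, a ≠ p.1 ∧ b ≠ p.2 ∧ (R.Adj a p.1 ↔ Q.Adj b p.2) := by
    intro p hp
    refine ⟨fun h' => h ⟨p.2, by rw [h']; exact hp⟩, ?_, ?_⟩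
    · rintro rfl
      by_cases hadj : R.Adj a p.1
      · exact hbV (Finset.mem_image_of_mem _ (Finset.mem_filter.2 ⟨hp, hadj⟩))
      · exact hbU (Finset.mem_image_of_mem _ (Finset.mem_filter.2 ⟨hp, hadj⟩))
    · by_cases hadj : R.Adj a p.1
      · exact iff_of_true hadj
          (hV _ (Finset.mem_image_of_mem _ (Finset.mem_filter.2 ⟨hp, hadj⟩)))
      · exact iff_of_false hadj
          (hU _ (Finset.mem_image_of_mem _ (Finset.mem_filter.2 ⟨hp, hadj⟩)))
  refine ⟨⟨insert (a, b) f, fun p hp q hq => ?_⟩, ⟨b, Finset.mem_insert_self _ _⟩,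
    Finset.subset_insert _ _⟩
  rw [Finset.mem_insert] at hp hq
  rcases hp with rfl | hp <;> rcases hq with rfl | hq
  · simp
  · obtain ⟨h1, h2, h3⟩ := hnew q hq
    exact ⟨iff_of_false h1 h2, h3⟩
  · obtain ⟨h1, h2, h3⟩ := hnew p hp
    exact ⟨iff_of_false h1.symm h2.symm, by rw [R.adj_comm, Q.adj_comm]; exact h3⟩
  · exact hf p hp q hq

/-- The inverse of a partial isomorphism. -/
def symm (f : PartialGraphIso R Q) : PartialGraphIso Q R :=
  ⟨f.val.map (Equiv.prodComm α β).toEmbedding, by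
    intro p hp q hq
    rw [Finset.mem_map] at hp hq
    obtain ⟨p, hp, rfl⟩ := hp
    obtain ⟨q, hq, rfl⟩ := hq
    exact ⟨(f.2 p hp q hq).1.symm, (f.2 p hp q hq).2.symm⟩⟩

theorem mem_symm {f : PartialGraphIso R Q} {a : α} {b : β} :
    (b, a) ∈ f.symm.val ↔ (a, b) ∈ f.val := by
  simp [symm]

theorem exists_extension_right (hR : IsRadoGraph R) (f : PartialGraphIso R Q) (b : β) :
    ∃ g : PartialGraphIso R Q, (∃ a, (a, b) ∈ g.val) ∧ f ≤ g := by
  obtain ⟨g, ⟨a, ha⟩, hfg⟩ := exists_extension_left hR f.symm b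
  refine ⟨g.symm, ⟨a, mem_symm.2 ha⟩, fun p hp => ?_⟩
  exact mem_symm.2 (hfg (mem_symm.2 hp))

end PartialGraphIso

/-- Any two Rado graphs are isomorphic, by a back-and-forth argument. -/
theorem IsRadoGraph.nonempty_iso {α β : Type*} {R : SimpleGraph α} {Q : SimpleGraph β}
    (hR : IsRadoGraph R) (hQ : IsRadoGraph Q) : Nonempty (R ≃g Q) := by
  have := hR.countable
  have := hQ.countable
  cases nonempty_encodable α
  cases nonempty_encodable β
  let D : α ⊕ β → Order.Cofinal (PartialGraphIso R Q) := Sum.elim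
    (fun a => ⟨{g | ∃ b, (a, b) ∈ g.val}, fun f => PartialGraphIso.exists_extension_left hQ f a⟩)
    (fun b => ⟨{g | ∃ a, (a, b) ∈ g.val}, fun f => PartialGraphIso.exists_extension_right hR f b⟩)
  let I := Order.idealOfCofinals (default : PartialGraphIso R Q) D
  have hl : ∀ a, ∃ b, ∃ f ∈ I, (a, b) ∈ f.val := fun a => by
    obtain ⟨f, ⟨b, hb⟩, hf⟩ := Order.cofinal_meets_idealOfCofinals default D (Sum.inl a)
    exact ⟨b, f, hf, hb⟩
  have hr : ∀ b, ∃ a, ∃ f ∈ I, (a, b) ∈ f.val := fun b => by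
    obtain ⟨f, ⟨a, ha⟩, hf⟩ := Order.cofinal_meets_idealOfCofinals default D (Sum.inr b)
    exact ⟨a, f, hf, ha⟩
  choose F hF using hl
  choose F' hF' using hr
  have key : ∀ {a b a' b'}, (∃ f ∈ I, (a, b) ∈ f.val) → (∃ f ∈ I, (a', b') ∈ f.val) →
      (a = a' ↔ b = b') ∧ (R.Adj a a' ↔ Q.Adj b b') := by
    rintro a b a' b' ⟨f, hf, hab⟩ ⟨g, hg, hab'⟩
    obtain ⟨m, -, hfm, hgm⟩ := I.directed _ hf _ hg
    exact m.2 (a, b) (hfm hab) (a', b') (hgm hab')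
  exact ⟨{
    toFun := F
    invFun := F'
    left_inv := fun a => (key (hF' (F a)) (hF a)).1.2 rfl
    right_inv := fun b => (key (hF (F' b)) (hF' b)).1.1 rfl
    map_rel_iff' := fun {a a'} => (key (hF a) (hF a')).2.symm }⟩

theorem IsRadoGraph.compl {W : Type*} {R : SimpleGraph W} (hR : IsRadoGraph R) :
    IsRadoGraph Rᶜ where
  countable := hR.countable
  infinite := hR.infinite
  extension U V hUV := by
    obtain ⟨w, hwV, hwU, h1, h2⟩ := hR.extension V U hUV.symm
    exact ⟨w, hwU, hwV, fun v hv => ⟨fun h => hwV (h ▸ hv), h2 v hv⟩, fun u hu h => h.2 (h1 u hu)⟩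

theorem compl_addIsolated_compl {W : Type*} (R : SimpleGraph W) (n : ℕ) :
    (addIsolated Rᶜ n)ᶜ = addUniversal R n := by
  ext a b
  rcases a with a | a <;> rcases b with b | b <;>
    simp [addIsolated, addUniversal, R.adj_comm]
  exact Or.inl

/-- The extension property of a graph `L` on `ℕ` for sets of vertices none of which is isolated or
universal, with arbitrarily late witnesses. -/
def HasExtensions (L : SimpleGraph ℕ) : Prop :=
  ∀ U V : Finset ℕ, Disjoint U V → (∀ v ∈ V, ∃ w, L.Adj v w) →
    (∀ u ∈ U, ∃ x, x ≠ u ∧ ¬ L.Adj u x) →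
    ∀ n, ∃ w > n, (∀ v ∈ V, L.Adj w v) ∧ ∀ u ∈ U, ¬ L.Adj w u

theorem HasExtensions.compl {L : SimpleGraph ℕ} (h : HasExtensions L) : HasExtensions Lᶜ := by
  intro U V hUV hV hU n
  obtain ⟨w, hw, h1, h2⟩ := h V U hUV.symm (fun u hu => by
    obtain ⟨x, hx, h'⟩ := hU u hu
    by_contra hne
    push Not at hne
    exact h' ⟨hx.symm, hne x⟩) (fun v hv => by
    obtain ⟨x, hx⟩ := hV v hv
    exact ⟨x, hx.1.symm, hx.2⟩) (max n (V.sup id))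
  refine ⟨w, (le_max_left _ _).trans_lt hw, fun v hv => ⟨?_, h2 v hv⟩, fun u hu h' => h'.2 (h1 u hu)⟩
  rintro rfl
  have := Finset.le_sup (f := id) hv
  exact absurd ((le_max_right _ _).trans_lt hw) (not_lt.2 this)

/-- Without universal vertices, the extension property applies to all the nonisolated vertices, which
therefore induce a Rado graph. -/
theorem HasExtensions.exists_iso_addIsolated {L : SimpleGraph ℕ} (h : HasExtensions L)
    (hfin : {v | ∀ w, ¬ L.Adj v w}.Finite) (huniv : ∀ u, ∃ x, x ≠ u ∧ ¬ L.Adj u x)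
    {W : Type*} {R : SimpleGraph W} (hR : IsRadoGraph R) :
    ∃ n, Nonempty (L ≃g addIsolated R n) := by
  classical
  set I : Set ℕ := {v | ∀ w, ¬ L.Adj v w}
  have hrado : IsRadoGraph (L.induce Iᶜ) := by
    refine ⟨inferInstance, hfin.infinite_compl.to_subtype, fun U V hUV => ?_⟩
    obtain ⟨n, hn⟩ : ∃ n, ∀ x ∈ I ∪ Subtype.val '' (↑(U ∪ V) : Set ↥Iᶜ), x ≤ n := by
      obtain ⟨n, hn⟩ := (hfin.union ((Finset.finite_toSet (U ∪ V)).image Subtype.val)).bddAbove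
      exact ⟨n, fun x hx => hn hx⟩
    obtain ⟨w, hw, h1, h2⟩ := h (U.map (Function.Embedding.subtype _))
      (V.map (Function.Embedding.subtype _)) ((Finset.disjoint_map _).2 hUV) (fun v hv => by
        obtain ⟨v, -, rfl⟩ := Finset.mem_map.1 hv
        have := v.2
        simp only [I, Set.mem_compl_iff, Set.mem_ofPred_eq, not_forall, not_not] at this
        exact this) (fun u _ => huniv u) n
    have hwI : w ∈ Iᶜ := fun hwI => absurd (hn w (Or.inl hwI)) (not_le.2 hw)
    have hnot : ∀ x ∈ U ∪ V, (⟨w, hwI⟩ : ↥Iᶜ) ≠ x := by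
      rintro x hx rfl
      exact absurd (hn w (Or.inr ⟨_, hx, rfl⟩)) (not_le.2 hw)
    exact ⟨⟨w, hwI⟩, fun h' => hnot _ (Finset.mem_union_left _ h') rfl,
      fun h' => hnot _ (Finset.mem_union_right _ h') rfl,
      fun v hv => h1 v (Finset.mem_map_of_mem _ hv),
      fun u hu => h2 u (Finset.mem_map_of_mem _ hu)⟩
  obtain ⟨φ⟩ := hrado.nonempty_iso hR
  have := hfin.to_subtype
  let e : L.induce Iᶜ ⊕g (⊥ : SimpleGraph I) ≃g L :=
    { toEquiv := (Equiv.sumComm _ _).trans (Equiv.Set.sumCompl I)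
      map_rel_iff' := by
        rintro (a | a) (b | b)
        · simp
        · simpa using fun h' => b.2 _ h'.symm
        · simpa using a.2 _
        · simpa using a.2 _ }
  let ε : (⊥ : SimpleGraph I) ≃g (⊥ : SimpleGraph (Fin (Nat.card I))) :=
    { toEquiv := Finite.equivFin I
      map_rel_iff' := Iff.rfl }
  exact ⟨Nat.card I, ⟨e.symm.trans (φ.sumCongr ε)⟩⟩

theorem HasExtensions.exists_iso {L : SimpleGraph ℕ} (h : HasExtensions L)
    (hiso : {v | ∀ w, ¬ L.Adj v w}.Finite) (huniv : {u | ∀ x, x ≠ u → L.Adj u x}.Finite)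
    {W : Type*} {R : SimpleGraph W} (hR : IsRadoGraph R) :
    (∃ n : ℕ, Nonempty (L ≃g addIsolated R n)) ∨ ∃ n : ℕ, Nonempty (L ≃g addUniversal R n) := by
  by_cases hu : ∀ u, ∃ x, x ≠ u ∧ ¬ L.Adj u x
  · exact Or.inl (h.exists_iso_addIsolated hiso hu hR)
  · right
    push Not at hu
    obtain ⟨u, hu⟩ := hu
    -- the universal vertex `u` prevents any vertex from being isolated
    have hno : ∀ v, ∃ x, x ≠ v ∧ ¬ Lᶜ.Adj v x := by
      intro v
      by_cases hv : v = u
      · refine ⟨u + 1, by omega, fun h' => h'.2 ?_⟩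
        rw [hv]
        exact hu _ (by omega)
      · exact ⟨u, Ne.symm hv, fun h' => h'.2 (hu v hv).symm⟩
    have hfin : {v | ∀ w, ¬ Lᶜ.Adj v w}.Finite := by
      refine huniv.subset fun v hv x hx => ?_
      by_contra h'
      exact hv x ⟨hx.symm, h'⟩
    obtain ⟨n, ⟨φ⟩⟩ := h.compl.exists_iso_addIsolated hfin hno hR.compl
    refine ⟨n, ⟨?_⟩⟩
    rw [← compl_addIsolated_compl]
    exact { toEquiv := φ.toEquiv
            map_rel_iff' := by
              intro a b
              have := φ.map_rel_iff' (a := a) (b := b)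
              simp only [SimpleGraph.compl_adj] at this ⊢
              rw [this]
              simp only [ne_eq, EmbeddingLike.apply_eq_iff_eq]
              by_cases hab : a = b
              · simp [hab]
              · simp [hab] }

/-! ### The complementary process -/

/-- The complement of `H` within `{0, …, t}`, as a graph on `ℕ`. -/
def complTrunc (t : ℕ) (H : SimpleGraph ℕ) : SimpleGraph ℕ := trunc t Hᶜ

theorem complTrunc_adj {t : ℕ} {H : SimpleGraph ℕ} {a b : ℕ} :
    (complTrunc t H).Adj a b ↔ (a ≠ b ∧ ¬ H.Adj a b) ∧ a ≤ t ∧ b ≤ t := Iff.rfl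

theorem supportedTo_complTrunc (t : ℕ) (H : SimpleGraph ℕ) : SupportedTo (complTrunc t H) t :=
  fun _ _ h => h.2.1

section

variable {H : SimpleGraph ℕ} {t : ℕ} {S : Finset ℕ}

theorem SupportedTo.complTrunc_complTrunc (hH : SupportedTo H t) :
    complTrunc t (complTrunc t H) = H := by
  ext a b
  simp only [complTrunc_adj]
  constructor
  · rintro ⟨⟨hne, h⟩, ha, hb⟩
    by_contra h'
    exact h ⟨⟨hne, h'⟩, ha, hb⟩
  · intro h
    exact ⟨⟨h.ne, fun h' => h'.1.2 h⟩, hH _ _ h, hH _ _ h.symm⟩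

theorem SupportedTo.complTrunc_addVertex (hH : SupportedTo H t) (hS : S ⊆ Finset.range (t + 1)) :
    complTrunc (t + 1) (addVertex H t S) =
      addVertex (complTrunc t H) t (Finset.range (t + 1) \ S) := by
  have hK := supportedTo_addVertex hH hS
  have hc := supportedTo_complTrunc t H
  have hd : Finset.range (t + 1) \ S ⊆ Finset.range (t + 1) := Finset.sdiff_subset
  have hKc := supportedTo_addVertex hc hd
  -- edges at the new vertex
  have key : ∀ b, (complTrunc (t + 1) (addVertex H t S)).Adj (t + 1) b ↔
      (addVertex (complTrunc t H) t (Finset.range (t + 1) \ S)).Adj (t + 1) b := by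
    intro b
    rw [hc.addVertex_adj_new hd, complTrunc_adj, hH.addVertex_adj_new hS, Finset.mem_sdiff,
      Finset.mem_range]
    constructor
    · rintro ⟨⟨hne, h⟩, -, hb⟩
      exact ⟨by omega, h⟩
    · rintro ⟨hb, h⟩
      exact ⟨⟨by omega, h⟩, by omega, by omega⟩
  ext a b
  by_cases ha : a = t + 1
  · rw [ha]
    exact key b
  by_cases hb : b = t + 1
  · rw [SimpleGraph.adj_comm, SimpleGraph.adj_comm _ a, hb]
    exact key a
  by_cases hat : a ≤ t
  · by_cases hbt : b ≤ t
    · rw [addVertex_adj_of_le hat hbt, complTrunc_adj, complTrunc_adj, addVertex_adj_of_le hat hbt]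
      refine and_congr_right fun _ => ?_
      omega
    · exact iff_of_false (fun h => by have := h.2.2; omega) fun h => by
        have := hKc _ _ h.symm
        omega
  · exact iff_of_false (fun h => by have := h.2.1; omega) fun h => by
      have := hKc _ _ h
      omega

theorem SupportedTo.deg_complTrunc_add (hH : SupportedTo H t) {u : ℕ} (hu : u ≤ t) :
    deg (complTrunc t H) u + deg H u = t := by
  have hunion : (complTrunc t H).neighborSet u ∪ H.neighborSet u =
      ((Finset.range (t + 1)).erase u : Finset ℕ) := by
    refine Set.Subset.antisymm (Set.union_subset
      ((supportedTo_complTrunc t H).neighborSet_subset u) (hH.neighborSet_subset u)) ?_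
    intro b hb
    obtain ⟨hne, hb⟩ := Finset.mem_erase.1 (Finset.mem_coe.1 hb)
    by_cases h : H.Adj u b
    · exact Or.inr h
    · exact Or.inl ⟨⟨hne.symm, h⟩, hu, Nat.lt_succ_iff.1 (Finset.mem_range.1 hb)⟩
  have hdisj : Disjoint ((complTrunc t H).neighborSet u) (H.neighborSet u) :=
    Set.disjoint_left.2 fun b h1 h2 => h1.1.2 h2
  rw [deg, deg, ← Set.ncard_union_eq hdisj ((supportedTo_complTrunc t H).finite_neighborSet u)
    (hH.finite_neighborSet u), hunion, Set.ncard_coe_finset,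
    Finset.card_erase_of_mem (Finset.mem_range.2 (by omega)), Finset.card_range,
    Nat.add_sub_cancel]

/-- Here `t` must be positive: at `t = 0` the junk value `0 / 0 = 0` breaks the symmetry between edges
and non-edges. -/
theorem SupportedTo.attachProb_complTrunc (hH : SupportedTo H t) (ht : 0 < t) :
    attachProb (complTrunc t H) t (Finset.range (t + 1) \ S) = attachProb H t S := by
  refine Finset.prod_congr rfl fun u hu => ?_
  have h : (deg (complTrunc t H) u : ℝ) = t - deg H u := by
    have := hH.deg_complTrunc_add (Nat.lt_succ_iff.1 (Finset.mem_range.1 hu))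
    rw [eq_sub_iff_add_eq]
    exact_mod_cast this
  have ht' : (t : ℝ) ≠ 0 := by exact_mod_cast ht.ne'
  have h2 : ((t : ℝ) - deg H u) / t = 1 - deg H u / t := by field_simp
  simp only [Finset.mem_sdiff, hu, true_and, h, h2]
  split_ifs <;> simp_all

end

namespace IsProcess

variable {Ω : Type*} [MeasurableSpace Ω] {μ : Measure Ω} {v' : ℕ} {G' : SimpleGraph (Fin (v' + 1))}
  {G : ℕ → Ω → SimpleGraph ℕ}

/-- The complements of the graphs in a preferential attachment process form such a process, started
from the complement: a codegree `t - d` also grows with probability `(t - d) / t`. -/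
theorem compl (hG : IsProcess μ G' G) (hv' : 1 ≤ v') :
    IsProcess μ G'ᶜ fun t ω => complTrunc (max t v') (G t ω) where
  measurable t a b := by
    by_cases h : a ≠ b ∧ a ≤ max t v' ∧ b ≤ max t v'
    · have h' : {ω | (complTrunc (max t v') (G t ω)).Adj a b} = {ω | (G t ω).Adj a b}ᶜ := by
        ext ω
        simp only [Set.mem_ofPred_eq, Set.mem_compl_iff, complTrunc_adj]
        tauto
      rw [h']
      exact (hG.measurable t a b).compl
    · have h' : {ω | (complTrunc (max t v') (G t ω)).Adj a b} = ∅ := by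
        ext ω
        simp only [Set.mem_ofPred_eq, Set.mem_empty_iff_false, complTrunc_adj]
        tauto
      rw [h']
      exact MeasurableSet.empty
  init t ht ω := by
    rw [max_eq_right ht, hG.init t ht ω]
    ext a b
    simp only [complTrunc_adj, SimpleGraph.map_adj, SimpleGraph.compl_adj]
    constructor
    · rintro ⟨⟨hne, h⟩, ha, hb⟩
      refine ⟨⟨a, by omega⟩, ⟨b, by omega⟩, ⟨fun h' => hne (Fin.ext_iff.1 h'), fun h' => h ?_⟩,
        rfl, rfl⟩
      exact ⟨_, _, h', rfl, rfl⟩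
    · rintro ⟨x, y, ⟨hne, h⟩, rfl, rfl⟩
      refine ⟨⟨fun h' => hne (Fin.ext h'), ?_⟩, Nat.lt_succ_iff.1 x.2, Nat.lt_succ_iff.1 y.2⟩
      rintro ⟨x', y', h', hx, hy⟩
      rw [Fin.valEmbedding.injective hx, Fin.valEmbedding.injective hy] at h'
      exact h h'
  step t ht ω := by
    obtain ⟨S, hS, h⟩ := hG.step t ht ω
    refine ⟨Finset.range (t + 1) \ S, Finset.sdiff_subset, ?_⟩
    rw [max_eq_left ht, max_eq_left (le_trans ht (Nat.le_succ t)), h]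
    exact (hG.supportedTo ht ω).complTrunc_addVertex hS
  transition t ht K S hS := by
    rw [max_eq_left (le_trans ht (Nat.le_succ t)), max_eq_left ht]
    by_cases hK : SupportedTo K t
    · have h1 : ∀ {s ω} {L : SimpleGraph ℕ}, v' ≤ s → SupportedTo L s →
          (complTrunc s (G s ω) = L ↔ G s ω = complTrunc s L) := by
        intro s ω L hs hL
        constructor
        · rintro rfl
          exact (hG.supportedTo hs ω).complTrunc_complTrunc.symm
        · intro h
          rw [h, hL.complTrunc_complTrunc]
      simp only [h1 ht hK, h1 (le_trans ht (Nat.le_succ t)) (supportedTo_addVertex hK hS),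
        hK.complTrunc_addVertex hS, ← hK.attachProb_complTrunc (S := S) (by omega : 0 < t)]
      exact hG.transition t ht _ _ Finset.sdiff_subset
    · have h1 : ∀ ω, complTrunc t (G t ω) ≠ K := by
        rintro ω rfl
        exact hK (supportedTo_complTrunc t _)
      simp [h1]

theorem limitGraph_compl (hG : IsProcess μ G' G) (hv' : 1 ≤ v') (ω : Ω) :
    limitGraph (fun t ω => complTrunc (max t v') (G t ω)) ω = (limitGraph G ω)ᶜ := by
  ext a b
  set s := max v' (max a b)
  have hs : v' ≤ s := le_max_left _ _
  have ha : a ≤ s := (le_max_left _ _).trans (le_max_right _ _)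
  have hb : b ≤ s := (le_max_right _ _).trans (le_max_right _ _)
  rw [(hG.compl hv').limitGraph_adj hs ω ha hb, SimpleGraph.compl_adj, hG.limitGraph_adj hs ω ha hb,
    max_eq_left hs, complTrunc_adj]
  tauto

/-! ### The almost sure structure of the limit graph -/

theorem ae_limitGraph_eq_bot (hG : IsProcess μ G' G) (h : G' = ⊥) :
    ∀ᵐ ω ∂μ, limitGraph G ω = ⊥ := by
  have hmap : (⊥ : SimpleGraph (Fin (v' + 1))).map Fin.valEmbedding = ⊥ := by
    ext a b
    rw [SimpleGraph.map_adj]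
    simp
  have hv : ∀ t, ∀ᵐ ω ∂μ, v' ≤ t → G t ω = ⊥ := by
    intro t
    by_cases ht : v' ≤ t
    · induction t, ht using Nat.le_induction with
      | base =>
        refine .of_forall fun ω _ => ?_
        rw [hG.init v' le_rfl ω, h, hmap]
      | succ t ht ih =>
        have hS : ∀ᵐ ω ∂μ, ∀ S : Finset ℕ, S ⊆ Finset.range (t + 1) → S.Nonempty →
            ¬ (G t ω = ⊥ ∧ G (t + 1) ω = addVertex ⊥ t S) := by
          rw [ae_all_iff]
          intro S
          by_cases hS : S ⊆ Finset.range (t + 1) ∧ S.Nonempty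
          · obtain ⟨hS, u, hu⟩ := hS
            have h0 : attachProb ⊥ t S = 0 := by
              refine Finset.prod_eq_zero (hS hu) ?_
              rw [if_pos hu]
              simp [deg, SimpleGraph.neighborSet]
            have := hG.transition t ht ⊥ S hS
            rw [h0, ENNReal.ofReal_zero, mul_zero] at this
            filter_upwards [measure_eq_zero_iff_ae_notMem.1 this] with ω hω _ _
            exact hω
          · exact .of_forall fun ω h1 h2 => absurd ⟨h1, h2⟩ hS
        filter_upwards [ih, hS] with ω hω hω' _
        obtain ⟨S, hS, h'⟩ := hG.step t ht ω
        rw [hω ht] at h'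
        rcases S.eq_empty_or_nonempty with rfl | hne
        · rw [h']
          ext a b
          simp [addVertex_adj]
        · exact absurd ⟨hω ht, h'⟩ (hω' S hS hne)
    · exact .of_forall fun ω h' => absurd h' ht
  filter_upwards [ae_all_iff.2 hv] with ω hω
  refine iSup_eq_bot.2 fun t => ?_
  rcases le_total v' t with ht | ht
  · exact hω t ht
  · rw [hG.init t ht ω, h, hmap]

variable [IsProbabilityMeasure μ]

theorem ae_hasExtensions (hG : IsProcess μ G' G) : ∀ᵐ ω ∂μ, HasExtensions (limitGraph G ω) := by
  have h : ∀ᵐ ω ∂μ, ∀ (t : ℕ) (U V : Finset ℕ), v' ≤ t ∧ U ⊆ Finset.range (t + 1) ∧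
      V ⊆ Finset.range (t + 1) ∧ Disjoint U V → (∀ v ∈ V, 0 < deg (G t ω) v) →
      (∀ u ∈ U, deg (G t ω) u < t) →
      ∃ w > t, (∀ v ∈ V, (limitGraph G ω).Adj w v) ∧ ∀ u ∈ U, ¬ (limitGraph G ω).Adj w u := by
    rw [ae_all_iff]
    intro t
    rw [ae_all_iff]
    intro U
    rw [ae_all_iff]
    intro V
    by_cases hc : v' ≤ t ∧ U ⊆ Finset.range (t + 1) ∧ V ⊆ Finset.range (t + 1) ∧ Disjoint U V
    · filter_upwards [hG.ae_exists_witness hc.1 hc.2.1 hc.2.2.1 hc.2.2.2] with ω hω _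
      exact hω
    · exact .of_forall fun ω h => absurd h hc
  filter_upwards [h] with ω hω U V hUV hV hU n
  choose! f hf using hV
  choose! g hg using hU
  -- by time `t`, the graph shows that no member of `V` is isolated and none of `U` is universal
  obtain ⟨t, ht⟩ : ∃ t, ∀ x ∈ ({v', n} ∪ (U ∪ V) ∪ (V.image f ∪ U.image g) : Finset ℕ), x ≤ t :=
    ⟨_, fun x hx => Finset.le_sup (f := id) hx⟩
  have hv : v' ≤ t := ht _ (by simp)
  have hn : n ≤ t := ht _ (by simp)
  have hUt : ∀ u ∈ U, u ≤ t := fun u hu => ht _ (by simp [hu])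
  have hVt : ∀ v ∈ V, v ≤ t := fun v hv => ht _ (by simp [hv])
  have hft : ∀ v ∈ V, f v ≤ t := fun v hv => ht _
    (Finset.mem_union_right _ (Finset.mem_union_left _ (Finset.mem_image_of_mem f hv)))
  have hgt : ∀ u ∈ U, g u ≤ t := fun u hu => ht _
    (Finset.mem_union_right _ (Finset.mem_union_right _ (Finset.mem_image_of_mem g hu)))
  have hs := hG.supportedTo hv ω
  obtain ⟨w, hw, h1⟩ := hω t U V ⟨hv,
    fun u hu => Finset.mem_range.2 (Nat.lt_succ_of_le (hUt u hu)),
    fun v hv => Finset.mem_range.2 (Nat.lt_succ_of_le (hVt v hv)), hUV⟩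
    (fun v hvV => (Set.ncard_pos (hs.finite_neighborSet v)).2
      ⟨f v, (hG.limitGraph_adj hv ω (hVt v hvV) (hft v hvV)).1 (hf v hvV)⟩)
    (fun u hu => by
      have hpos : 0 < deg (complTrunc t (G t ω)) u :=
        (Set.ncard_pos ((supportedTo_complTrunc t _).finite_neighborSet u)).2
          ⟨g u, ⟨⟨(hg u hu).1.symm, fun h' => (hg u hu).2
            ((hG.limitGraph_adj hv ω (hUt u hu) (hgt u hu)).2 h')⟩, hUt u hu, hgt u hu⟩⟩
      have := hs.deg_complTrunc_add (hUt u hu)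
      omega)
  exact ⟨w, by omega, h1⟩

end IsProcess

end PrefAttach

theorem theorem1 {Ω : Type*} [MeasurableSpace Ω] (μ : Measure Ω) [IsProbabilityMeasure μ]
    (v' : ℕ) (hv' : 1 ≤ v') (G' : SimpleGraph (Fin (v' + 1)))
    (G : ℕ → Ω → SimpleGraph ℕ) (hG : PrefAttach.IsProcess μ G' G) :
    (G' = ⊤ → ∀ᵐ ω ∂μ, PrefAttach.limitGraph G ω = ⊤) ∧
    (G' = ⊥ → ∀ᵐ ω ∂μ, PrefAttach.limitGraph G ω = ⊥) ∧
    (G' ≠ ⊤ → G' ≠ ⊥ →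
      ∀ {W : Type*} (R : SimpleGraph W), PrefAttach.IsRadoGraph R →
        ∀ᵐ ω ∂μ,
          (∃ n : ℕ, Nonempty (PrefAttach.limitGraph G ω ≃g PrefAttach.addIsolated R n)) ∨
          (∃ n : ℕ, Nonempty (PrefAttach.limitGraph G ω ≃g PrefAttach.addUniversal R n))) := by
  refine ⟨fun h => ?_, fun h => hG.ae_limitGraph_eq_bot h, fun htop hbot W R hR => ?_⟩
  · filter_upwards [(hG.compl hv').ae_limitGraph_eq_bot (by rw [h, compl_top])] with ω hω
    rw [hG.limitGraph_compl hv' ω] at hω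
    exact compl_eq_bot.1 hω
  · filter_upwards [hG.ae_hasExtensions, hG.ae_finite_isolated hbot,
      (hG.compl hv').ae_finite_isolated fun h => htop (compl_eq_bot.1 h)] with ω hext hiso huniv
    rw [hG.limitGraph_compl hv' ω] at huniv
    refine hext.exists_iso hiso (huniv.subset fun u hu x hx => ?_) hR
    exact hx.2 (hu x hx.1.symm)
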